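/- **Soundness of linear hypergraphs for symmetric traced monoidal categories.** Let $\Sigma$ be a signature: a set of labels $\phi$, each with an arity $\mathrm{dom}(\phi)\in\mathbb N$ and a coarity $\mathrm{cod}(\phi)\in\mathbb N$. *Terms.* The terms $f : m\to n$ over $\Sigma$ are built from generators $\phi:\mathrm{dom}(\phi)\to\mathrm{cod}(\phi)$, identities $\mathrm{id}_n:n\to n$ and symmetries $\sigma_{m,n}:m+n\to n+m$ by composition $f\mathbin{;}g$, tensor $f\otimes g : m+p\to n+q$ (for $f:m\to n$, $g:p\to q$), and trace of the first $x$ wires, $\mathrm{Tr}^x(f):m\to n$ for $f:x+m\to x+n$. Two terms of the same type are *equal under the STMC theory* if they are related by the least congruence containing the axioms of strict symmetric traced monoidal categories, i.e. those of strict monoidal categories (category axioms, bifunctoriality, strict associativity and unitality of $\otimes$), those of the symmetry (naturality, self-inverse, both hexagons), and those of the trace (tightening, sliding, vanishing, superposing, yanking, exchange). The free traced PROP on $\Sigma$ has as morphisms the terms modulo this equality. *Hypergraphs.* A labelled linear hypergraph over $\Sigma$ consists of finite, disjoint, totally ordered sets $V^t$, $V^s$ of target and source vertices, a finite set $E$ of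 edges, functions $\mathrm{left}:V^t\to E+1$ and $\mathrm{right}:V^s\to E+1$, a bijection $\kappa:V^t\to V^s$, and a labelling $\lambda:E\to\Sigma$ such that each edge $e$ has exactly $\mathrm{dom}(\lambda(e))$ sources (elements of $\mathrm{right}^{-1}(e)$) and $\mathrm{cod}(\lambda(e))$ targets (elements of $\mathrm{left}^{-1}(e)$), listed in the vertex order. Its inputs and outputs are the ordered inverse images, under $\mathrm{left}$ and $\mathrm{right}$, of the extra point of $E+1$; the hypergraph is of type $m\to n$ if it has $m$ inputs and $n$ outputs. An isomorphism $F\equiv G$ is a triple of bijections on target vertices, source vertices and edges that preserves the ordered sources and targets of every edge, the connections $\kappa$, the labels, and the ordered lists of inputs and of outputs. *Interpretation.* $[\![-]\!]$ sends terms $m\to n$ to hypergraphs of type $m\to n$, by recursion: - $[\![\phi]\!]$ is the hypergraph with a single edge, labelled $\phi$, whose sources are connected in order to the inputs and whose targets are connected in order to the outputs. - $[\![\mathrm{id}_n]\!]$ has no edges and connects the $i$th input to the $i$th output. - $[\![\sigma_{m,n}]\!]$ is the composite swap, built recursively from identities and the two-wire swap, the edgeless hypergraph that crosses two wires. - $[\![f\mathbin{;}g]\!]$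 is the composite of $F=[\![f]\!]$ and $G=[\![g]\!]$: their disjoint union ($F$ before $G$), with the outputs of $F$ and the inputs of $G$ deleted, where each target vertex that was connected to the $i$th output of $F$ is connected to the source vertex to which the $i$th input of $G$ was connected. - $[\![f\otimes g]\!]$ is the disjoint union of $[\![f]\!]$ and $[\![g]\!]$, with the vertices of $[\![f]\!]$ before those of $[\![g]\!]$. - $[\![\mathrm{Tr}^x(f)]\!]$ is obtained from $[\![f]\!]$ by $x$ successive one-wire traces. A one-wire trace deletes the first input and the first output, and connects the target vertex that was connected to the first output (unless it is the deleted input) to the source vertex to which the first input was connected. **Claim.** For all terms $f,g:m\to n$ over $\Sigma$, if $f=g$ under the STMC theory, then $[\![f]\!]\equiv[\![g]\!]$. -/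

import Mathlib

universe u

/-- A hypergraph signature: a set of edge labels, each with an arity `dom` and a coarity `cod`. -/
structure Signature where
  Label : Type u
  dom : Label → ℕ
  cod : Label → ℕ

/-! ### Linear hypergraphs -/

/-- A linear hypergraph. The target vertices `vt` and the source vertices `vs` are finite totally
ordered sets (kept disjoint by being separate types), `E` is a finite set of edges, and
`Option E` plays the role of `E + 1`, with `none` the interface. -/
structure LinearHypergraph where
  vt : Type
  vs : Type
  E : Type
  vtFintype : Fintype vt
  vtOrder : LinearOrder vt
  vsFintype : Fintype vs
  vsOrder : LinearOrder vs
  edgeFintype : Fintype E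
  left : vt → Option E
  right : vs → Option E
  conn : vt → vs
  conn_bijective : Function.Bijective conn

attribute [instance] LinearHypergraph.vtFintype LinearHypergraph.vtOrder
  LinearHypergraph.vsFintype LinearHypergraph.vsOrder LinearHypergraph.edgeFintype

namespace LinearHypergraph

open Classical in
/-- The inputs: target vertices whose left end is on the interface. -/
noncomputable def inputs (H : LinearHypergraph) : Finset H.vt :=
  Finset.univ.filter fun v => H.left v = none

open Classical in
/-- The outputs: source vertices whose right end is on the interface. -/
noncomputable def outputs (H : LinearHypergraph) : Finset H.vs :=
  Finset.univ.filter fun v => H.right v = none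

open Classical in
/-- The ordered sources of an edge: the inverse image of the edge under `right`. -/
noncomputable def sources (H : LinearHypergraph) (e : H.E) : List H.vs :=
  (Finset.univ.filter fun v => H.right v = some e).sort (· ≤ ·)

open Classical in
/-- The ordered targets of an edge: the inverse image of the edge under `left`. -/
noncomputable def targets (H : LinearHypergraph) (e : H.E) : List H.vt :=
  (Finset.univ.filter fun v => H.left v = some e).sort (· ≤ ·)

theorem mem_inputs {H : LinearHypergraph} {v : H.vt} : v ∈ H.inputs ↔ H.left v = none := by
  simp [inputs]

theorem mem_outputs {H : LinearHypergraph} {v : H.vs} : v ∈ H.outputs ↔ H.right v = none := by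
  simp [outputs]

theorem length_sources (H : LinearHypergraph) (e : H.E) :
    (H.sources e).length = Nat.card {v : H.vs // H.right v = some e} := by
  classical
  rw [sources, Finset.length_sort, Nat.card_eq_fintype_card, Fintype.card_subtype]

theorem length_targets (H : LinearHypergraph) (e : H.E) :
    (H.targets e).length = Nat.card {v : H.vt // H.left v = some e} := by
  classical
  rw [targets, Finset.length_sort, Nat.card_eq_fintype_card, Fintype.card_subtype]

theorem card_inputs_eq (H : LinearHypergraph) :
    H.inputs.card = Nat.card {v : H.vt // H.left v = none} := by
  classical
  rw [inputs, Nat.card_eq_fintype_card, Fintype.card_subtype]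

theorem card_outputs_eq (H : LinearHypergraph) :
    H.outputs.card = Nat.card {v : H.vs // H.right v = none} := by
  classical
  rw [outputs, Nat.card_eq_fintype_card, Fintype.card_subtype]

end LinearHypergraph

/-- A labelled linear hypergraph over a signature. -/
structure LabelledLinearHypergraph (S : Signature.{u}) extends LinearHypergraph where
  label : E → S.Label
  dom_label : ∀ e, S.dom (label e) = (toLinearHypergraph.sources e).length
  cod_label : ∀ e, S.cod (label e) = (toLinearHypergraph.targets e).length

namespace LabelledLinearHypergraph

/-- A homomorphism of labelled linear hypergraphs. -/
structure Hom {S : Signature.{u}} (F G : LabelledLinearHypergraph S) where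
  vmapt : F.vt → G.vt
  vmaps : F.vs → G.vs
  emap : F.E → G.E
  sources_pres : ∀ e, (F.sources e).map vmaps = G.sources (emap e)
  targets_pres : ∀ e, (F.targets e).map vmapt = G.targets (emap e)
  conn_pres : ∀ v, vmaps (F.conn v) = G.conn (vmapt v)
  label_pres : ∀ e, G.label (emap e) = F.label e

/-- `F ≡ G`: there is a homomorphism with bijective components which moreover preserves the
ordered inputs and the ordered outputs. -/
def Isomorphic {S : Signature.{u}} (F G : LabelledLinearHypergraph S) : Prop :=
  ∃ h : Hom F G,
    Function.Bijective h.vmapt ∧ Function.Bijective h.vmaps ∧ Function.Bijective h.emap ∧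
    (F.inputs.sort (· ≤ ·)).map h.vmapt = G.inputs.sort (· ≤ ·) ∧
    (F.outputs.sort (· ≤ ·)).map h.vmaps = G.outputs.sort (· ≤ ·)

end LabelledLinearHypergraph

/-- A labelled linear hypergraph of type `m → n`: it has `m` inputs and `n` outputs. -/
structure Hyp (S : Signature.{u}) (m n : ℕ) extends LabelledLinearHypergraph S where
  card_inputs : toLinearHypergraph.inputs.card = m
  card_outputs : toLinearHypergraph.outputs.card = n

/-! ### Counting helpers -/

theorem card_lexSum {α β : Type} [Finite α] [Finite β] (p : α ⊕ₗ β → Prop) :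
    Nat.card {v // p v} =
      Nat.card {a // p (Sum.inlₗ a)} + Nat.card {b // p (Sum.inrₗ b)} := by
  rw [← Nat.card_sum]
  exact Nat.card_congr (Equiv.subtypeSum (p := fun v : α ⊕ β => p (toLex v)))

theorem card_subtype_subtype {α : Type} (q p : α → Prop) (h : ∀ a, p a → q a) :
    Nat.card {v : {a // q a} // p v.1} = Nat.card {a // p a} :=
  Nat.card_congr (Equiv.subtypeSubtypeEquivSubtype (fun {x} hx => h x hx))

theorem card_subtype_iff {α : Type} (q p : α → Prop) (h : ∀ a, q a ↔ p a) {k : ℕ}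
    (hk : k = Nat.card {a // p a}) : Nat.card {a // q a} = k :=
  (Nat.card_congr (Equiv.subtypeEquivRight h)).trans hk.symm

/-- Counting in `α ⊕ₗ β`, one summand at a time. -/
theorem card_lexSum_of {α β : Type} [Finite α] [Finite β] (p : α ⊕ₗ β → Prop) {i j k : ℕ}
    (hα : Nat.card {a // p (Sum.inlₗ a)} = i) (hβ : Nat.card {b // p (Sum.inrₗ b)} = j)
    (hk : i + j = k) : Nat.card {v // p v} = k := by
  rw [card_lexSum, hα, hβ, hk]

/-- Counting in a subtype that contains everything counted. -/
theorem card_sub_of {α : Type} (r p : α → Prop) (q : {a // r a} → Prop) {k : ℕ}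
    (hr : ∀ a, p a → r a) (hq : ∀ a, q a ↔ p a.1) (hk : k = Nat.card {a // p a}) :
    Nat.card {v : {a // r a} // q v} = k := by
  rw [hk, ← card_subtype_subtype r p hr]
  exact Nat.card_congr (Equiv.subtypeEquivRight hq)

theorem card_subtype_false {α : Type} (p : α → Prop) (h : ∀ a, ¬ p a) :
    Nat.card {a // p a} = 0 := by
  have : IsEmpty {a // p a} := ⟨fun a => h a.1 a.2⟩
  exact Nat.card_of_isEmpty

/-- Counting with one of the counted elements removed. -/
theorem card_remove {α : Type} [Finite α] (p : α → Prop) (a : α) (ha : p a) {k : ℕ}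
    (hk : Nat.card {v // p v} = 1 + k) : Nat.card {v : {v // v ≠ a} // p v.1} = k := by
  classical
  have := Fintype.ofFinite α
  rw [Nat.card_eq_fintype_card, Fintype.card_subtype] at hk
  have h₁ : Nat.card {v : {v // v ≠ a} // p v.1} = Nat.card {v // v ≠ a ∧ p v} :=
    Nat.card_congr (Equiv.subtypeSubtypeEquivSubtypeInter (fun v => v ≠ a) p)
  rw [h₁, Nat.card_eq_fintype_card, Fintype.card_subtype]
  have h₂ : Finset.univ.filter (fun v => v ≠ a ∧ p v) = (Finset.univ.filter p).erase a := by
    ext v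
    simp
  rw [h₂, Finset.card_erase_of_mem (by simpa using ha), hk]
  omega

namespace Hyp

variable {S : Signature.{u}} {m n p q x : ℕ}

/-- The `i`th input. -/
noncomputable def input (F : Hyp S m n) (i : Fin m) : F.vt :=
  F.inputs.orderEmbOfFin F.card_inputs i

/-- The `i`th output. -/
noncomputable def output (F : Hyp S m n) (i : Fin n) : F.vs :=
  F.outputs.orderEmbOfFin F.card_outputs i

/-- The position of a vertex among the outputs. -/
noncomputable def outputIdx (F : Hyp S m n) (v : F.vs) (hv : F.right v = none) : Fin n :=
  (F.outputs.orderIsoOfFin F.card_outputs).symm ⟨v, LinearHypergraph.mem_outputs.2 hv⟩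

/-- The position of a vertex among the inputs. -/
noncomputable def inputIdx (F : Hyp S m n) (v : F.vt) (hv : F.left v = none) : Fin m :=
  (F.inputs.orderIsoOfFin F.card_inputs).symm ⟨v, LinearHypergraph.mem_inputs.2 hv⟩

theorem left_input (F : Hyp S m n) (i : Fin m) : F.left (F.input i) = none :=
  LinearHypergraph.mem_inputs.1 (Finset.orderEmbOfFin_mem _ _ _)

theorem right_output (F : Hyp S m n) (i : Fin n) : F.right (F.output i) = none :=
  LinearHypergraph.mem_outputs.1 (Finset.orderEmbOfFin_mem _ _ _)

theorem input_inputIdx (F : Hyp S m n) (v : F.vt) (hv : F.left v = none) :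
    F.input (F.inputIdx v hv) = v := by
  rw [input, ← Finset.coe_orderIsoOfFin_apply, inputIdx, OrderIso.apply_symm_apply]

theorem output_outputIdx (F : Hyp S m n) (v : F.vs) (hv : F.right v = none) :
    F.output (F.outputIdx v hv) = v := by
  rw [output, ← Finset.coe_orderIsoOfFin_apply, outputIdx, OrderIso.apply_symm_apply]

theorem input_injective (F : Hyp S m n) : Function.Injective F.input :=
  (F.inputs.orderEmbOfFin F.card_inputs).injective

theorem output_injective (F : Hyp S m n) : Function.Injective F.output :=
  (F.outputs.orderEmbOfFin F.card_outputs).injective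

/-- The same hypergraph, with its type rewritten along equalities of numbers. -/
def cast {m' n' : ℕ} (hm : m = m') (hn : n = n') (F : Hyp S m n) : Hyp S m' n' where
  toLabelledLinearHypergraph := F.toLabelledLinearHypergraph
  card_inputs := F.card_inputs.trans hm
  card_outputs := F.card_outputs.trans hn

/-- The identity hypergraph on `n` wires. -/
def id (S : Signature.{u}) (n : ℕ) : Hyp S n n where
  vt := Fin n
  vs := Fin n
  E := Empty
  vtFintype := inferInstance
  vtOrder := inferInstance
  vsFintype := inferInstance
  vsOrder := inferInstance
  edgeFintype := inferInstance
  left _ := none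
  right _ := none
  conn i := i
  conn_bijective := Function.bijective_id
  label e := e.elim
  dom_label e := e.elim
  cod_label e := e.elim
  card_inputs := by simp [LinearHypergraph.inputs]
  card_outputs := by simp [LinearHypergraph.outputs]

/-- The swap hypergraph on two wires. -/
def swap₁₁ (S : Signature.{u}) : Hyp S (1 + 1) (1 + 1) where
  vt := Fin 2
  vs := Fin 2
  E := Empty
  vtFintype := inferInstance
  vtOrder := inferInstance
  vsFintype := inferInstance
  vsOrder := inferInstance
  edgeFintype := inferInstance
  left _ := none
  right _ := none
  conn i := Equiv.swap 0 1 i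
  conn_bijective := (Equiv.swap 0 1).bijective
  label e := e.elim
  dom_label e := e.elim
  cod_label e := e.elim
  card_inputs := by simp [LinearHypergraph.inputs]
  card_outputs := by simp [LinearHypergraph.outputs]

/-- The interpretation of a generator: a single edge, its sources connected to the inputs and its
targets connected to the outputs. -/
def gen {S : Signature.{u}} (φ : S.Label) : Hyp S (S.dom φ) (S.cod φ) where
  vt := Fin (S.dom φ) ⊕ₗ Fin (S.cod φ)
  vs := Fin (S.dom φ) ⊕ₗ Fin (S.cod φ)
  E := Unit
  vtFintype := inferInstance
  vtOrder := inferInstance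
  vsFintype := inferInstance
  vsOrder := inferInstance
  edgeFintype := inferInstance
  left v := Sum.elim (fun _ => none) (fun _ => some ()) (ofLex v)
  right v := Sum.elim (fun _ => some ()) (fun _ => none) (ofLex v)
  conn v := v
  conn_bijective := Function.bijective_id
  label _ := φ
  dom_label e := by
    rw [LinearHypergraph.length_sources, card_lexSum]
    simp
  cod_label e := by
    rw [LinearHypergraph.length_targets, card_lexSum]
    simp
  card_inputs := by
    rw [LinearHypergraph.card_inputs_eq, card_lexSum]
    simp
  card_outputs := by
    rw [LinearHypergraph.card_outputs_eq, card_lexSum]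
    simp

open Classical in
/-- The connections of a composite: a target vertex of `F` connected to the `i`th output of `F`
is connected to whatever the `i`th input of `G` was connected to; all others are unchanged. -/
noncomputable def seqConn (F : Hyp S m n) (G : Hyp S n p) :
    F.vt ⊕ₗ {v : G.vt // G.left v ≠ none} → {v : F.vs // F.right v ≠ none} ⊕ₗ G.vs :=
  fun v => Sum.elim
    (fun v => if h : F.right (F.conn v) = none
      then Sum.inrₗ (G.conn (G.input (F.outputIdx (F.conn v) h)))
      else Sum.inlₗ ⟨F.conn v, h⟩)
    (fun v => Sum.inrₗ (G.conn v.1)) (ofLex v)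

theorem seqConn_bijective (F : Hyp S m n) (G : Hyp S n p) :
    Function.Bijective (seqConn F G) := by
  classical
  have e₁ : ∀ v (h : F.right (F.conn v) = none), seqConn F G (Sum.inlₗ v) =
      Sum.inrₗ (G.conn (G.input (F.outputIdx (F.conn v) h))) := fun v h => dif_pos h
  have e₂ : ∀ v (h : ¬ F.right (F.conn v) = none), seqConn F G (Sum.inlₗ v) =
      Sum.inlₗ ⟨F.conn v, h⟩ := fun v h => dif_neg h
  have e₃ : ∀ v, seqConn F G (Sum.inrₗ v) = Sum.inrₗ (G.conn v.1) := fun v => rfl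
  have inl_inj : ∀ {α β : Type} {a b : α}, (Sum.inlₗ a : α ⊕ₗ β) = Sum.inlₗ b → a = b :=
    fun h => Sum.inl_injective (toLex.injective h)
  have inr_inj : ∀ {α β : Type} {a b : β}, (Sum.inrₗ a : α ⊕ₗ β) = Sum.inrₗ b → a = b :=
    fun h => Sum.inr_injective (toLex.injective h)
  have ne : ∀ {α β : Type} {a : α} {b : β}, (Sum.inlₗ a : α ⊕ₗ β) = Sum.inrₗ b → False :=
    fun h => Sum.inl_ne_inr (toLex.injective h)
  constructor
  · rintro (v | v) (w | w) h
    · change seqConn F G (Sum.inlₗ v) = seqConn F G (Sum.inlₗ w) at h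
      by_cases hv : F.right (F.conn v) = none <;> by_cases hw : F.right (F.conn w) = none
      · rw [e₁ v hv, e₁ w hw] at h
        have h' := G.input_injective (G.conn_bijective.1 (inr_inj h))
        have := congrArg F.output h'
        rw [output_outputIdx, output_outputIdx] at this
        rw [F.conn_bijective.1 this]
      · rw [e₁ v hv, e₂ w hw] at h
        exact (ne h.symm).elim
      · rw [e₂ v hv, e₁ w hw] at h
        exact (ne h).elim
      · rw [e₂ v hv, e₂ w hw] at h
        rw [F.conn_bijective.1 (congrArg Subtype.val (inl_inj h))]
    · change seqConn F G (Sum.inlₗ v) = seqConn F G (Sum.inrₗ w) at h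
      rw [e₃] at h
      by_cases hv : F.right (F.conn v) = none
      · rw [e₁ v hv] at h
        exact (w.2 (G.conn_bijective.1 (inr_inj h) ▸ G.left_input _)).elim
      · rw [e₂ v hv] at h
        exact (ne h).elim
    · change seqConn F G (Sum.inrₗ v) = seqConn F G (Sum.inlₗ w) at h
      rw [e₃] at h
      by_cases hw : F.right (F.conn w) = none
      · rw [e₁ w hw] at h
        exact (v.2 (G.conn_bijective.1 (inr_inj h) ▸ G.left_input _)).elim
      · rw [e₂ w hw] at h
        exact (ne h.symm).elim
    · change seqConn F G (Sum.inrₗ v) = seqConn F G (Sum.inrₗ w) at h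
      rw [e₃, e₃] at h
      rw [Subtype.ext (G.conn_bijective.1 (inr_inj h))]
  · rintro (w | w)
    · obtain ⟨v, hv⟩ := F.conn_bijective.2 w.1
      refine ⟨Sum.inlₗ v, (e₂ v (hv ▸ w.2)).trans ?_⟩
      exact congrArg Sum.inlₗ (Subtype.ext hv)
    · obtain ⟨v, hv⟩ := G.conn_bijective.2 w
      by_cases h : G.left v = none
      · obtain ⟨u, hu⟩ := F.conn_bijective.2 (F.output (G.inputIdx v h))
        have hr : F.right (F.conn u) = none := hu ▸ F.right_output _
        refine ⟨Sum.inlₗ u, (e₁ u hr).trans ?_⟩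
        have : F.outputIdx (F.conn u) hr = G.inputIdx v h :=
          F.output_injective ((output_outputIdx _ _ _).trans hu)
        rw [this, input_inputIdx, hv]
        rfl
      · exact ⟨Sum.inrₗ ⟨v, h⟩, (e₃ _).trans (congrArg Sum.inrₗ hv)⟩

/-- Composition in sequence: the outputs of `F` and the inputs of `G` are deleted. -/
noncomputable def seq (F : Hyp S m n) (G : Hyp S n p) : Hyp S m p where
  vt := F.vt ⊕ₗ {v : G.vt // G.left v ≠ none}
  vs := {v : F.vs // F.right v ≠ none} ⊕ₗ G.vs
  E := F.E ⊕ G.E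
  vtFintype := Fintype.ofFinite _
  vtOrder := inferInstance
  vsFintype := Fintype.ofFinite _
  vsOrder := inferInstance
  edgeFintype := inferInstance
  left v := Sum.elim (fun v => (F.left v).map Sum.inl) (fun v => (G.left v.1).map Sum.inr) (ofLex v)
  right v :=
    Sum.elim (fun v => (F.right v.1).map Sum.inl) (fun v => (G.right v).map Sum.inr) (ofLex v)
  conn := seqConn F G
  conn_bijective := seqConn_bijective F G
  label := Sum.elim F.label G.label
  dom_label := by
    rintro (e | e) <;> rw [LinearHypergraph.length_sources]
    · exact (card_lexSum_of _
        (card_sub_of _ (fun v => F.right v = some e) _ (by simp_all) (by simp)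
          (F.length_sources e))
        (card_subtype_false _ (by simp)) ((Nat.add_zero _).trans (F.dom_label e).symm)).symm
    · exact (card_lexSum_of _ (card_subtype_false _ (by simp))
        (card_subtype_iff _ (fun v => G.right v = some e) (by simp) (G.length_sources e))
        ((Nat.zero_add _).trans (G.dom_label e).symm)).symm
  cod_label := by
    rintro (e | e) <;> rw [LinearHypergraph.length_targets]
    · exact (card_lexSum_of _
        (card_subtype_iff _ (fun v => F.left v = some e) (by simp) (F.length_targets e))
        (card_subtype_false _ (by simp)) ((Nat.add_zero _).trans (F.cod_label e).symm)).symm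
    · exact (card_lexSum_of _ (card_subtype_false _ (by simp))
        (card_sub_of _ (fun v => G.left v = some e) _ (by simp_all) (by simp)
          (G.length_targets e))
        ((Nat.zero_add _).trans (G.cod_label e).symm)).symm
  card_inputs := by
    rw [LinearHypergraph.card_inputs_eq]
    exact card_lexSum_of _
      (card_subtype_iff _ (fun v => F.left v = none) (by simp) F.card_inputs_eq)
      (card_subtype_false _ (fun v => by simpa using v.2))
      ((Nat.add_zero _).trans F.card_inputs)
  card_outputs := by
    rw [LinearHypergraph.card_outputs_eq]
    exact card_lexSum_of _
      (card_subtype_false _ (fun v => by simpa using v.2))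
      (card_subtype_iff _ (fun v => G.right v = none) (by simp) G.card_outputs_eq)
      ((Nat.zero_add _).trans G.card_outputs)

/-- The monoidal tensor: disjoint union, with `F` before `G` in all orders. -/
noncomputable def tensor (F : Hyp S m n) (G : Hyp S p q) : Hyp S (m + p) (n + q) where
  vt := F.vt ⊕ₗ G.vt
  vs := F.vs ⊕ₗ G.vs
  E := F.E ⊕ G.E
  vtFintype := inferInstance
  vtOrder := inferInstance
  vsFintype := inferInstance
  vsOrder := inferInstance
  edgeFintype := inferInstance
  left v := Sum.elim (fun v => (F.left v).map Sum.inl) (fun v => (G.left v).map Sum.inr) (ofLex v)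
  right v := Sum.elim (fun v => (F.right v).map Sum.inl) (fun v => (G.right v).map Sum.inr) (ofLex v)
  conn v := toLex (Sum.map F.conn G.conn (ofLex v))
  conn_bijective := (toLex.bijective.comp
    (Sum.map_bijective.2 ⟨F.conn_bijective, G.conn_bijective⟩)).comp ofLex.bijective
  label := Sum.elim F.label G.label
  dom_label := by
    rintro (e | e) <;> rw [LinearHypergraph.length_sources]
    · exact (card_lexSum_of _
        (card_subtype_iff _ (fun v => F.right v = some e) (by simp) (F.length_sources e))
        (card_subtype_false _ (by simp)) ((Nat.add_zero _).trans (F.dom_label e).symm)).symm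
    · exact (card_lexSum_of _ (card_subtype_false _ (by simp))
        (card_subtype_iff _ (fun v => G.right v = some e) (by simp) (G.length_sources e))
        ((Nat.zero_add _).trans (G.dom_label e).symm)).symm
  cod_label := by
    rintro (e | e) <;> rw [LinearHypergraph.length_targets]
    · exact (card_lexSum_of _
        (card_subtype_iff _ (fun v => F.left v = some e) (by simp) (F.length_targets e))
        (card_subtype_false _ (by simp)) ((Nat.add_zero _).trans (F.cod_label e).symm)).symm
    · exact (card_lexSum_of _ (card_subtype_false _ (by simp))
        (card_subtype_iff _ (fun v => G.left v = some e) (by simp) (G.length_targets e))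
        ((Nat.zero_add _).trans (G.cod_label e).symm)).symm
  card_inputs := by
    rw [LinearHypergraph.card_inputs_eq]
    exact card_lexSum_of _
      (card_subtype_iff _ (fun v => F.left v = none) (by simp) F.card_inputs_eq)
      (card_subtype_iff _ (fun v => G.left v = none) (by simp) G.card_inputs_eq)
      (congrArg₂ _ F.card_inputs G.card_inputs)
  card_outputs := by
    rw [LinearHypergraph.card_outputs_eq]
    exact card_lexSum_of _
      (card_subtype_iff _ (fun v => F.right v = none) (by simp) F.card_outputs_eq)
      (card_subtype_iff _ (fun v => G.right v = none) (by simp) G.card_outputs_eq)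
      (congrArg₂ _ F.card_outputs G.card_outputs)

open Classical in
/-- The connections of a trace of one wire: the vertex connected to the first output is
connected to whatever the first input was connected to; all others are unchanged. -/
noncomputable def traceConn (F : Hyp S (1 + m) (1 + n)) :
    {v : F.vt // v ≠ F.input (Fin.castAdd m 0)} → {v : F.vs // v ≠ F.output (Fin.castAdd n 0)} :=
  fun v => if h : F.conn v.1 = F.output (Fin.castAdd n 0)
    then ⟨F.conn (F.input (Fin.castAdd m 0)), fun h' =>
      v.2 (F.conn_bijective.1 (h.trans h'.symm))⟩
    else ⟨F.conn v.1, h⟩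

theorem traceConn_bijective (F : Hyp S (1 + m) (1 + n)) :
    Function.Bijective (traceConn F) := by
  classical
  have e₁ : ∀ v, F.conn v.1 = F.output (Fin.castAdd n 0) →
      (traceConn F v).1 = F.conn (F.input (Fin.castAdd m 0)) :=
    fun v h => congrArg Subtype.val (dif_pos h)
  have e₂ : ∀ v, ¬ F.conn v.1 = F.output (Fin.castAdd n 0) →
      (traceConn F v).1 = F.conn v.1 := fun v h => congrArg Subtype.val (dif_neg h)
  constructor
  · intro v w h
    have h := congrArg Subtype.val h
    by_cases hv : F.conn v.1 = F.output (Fin.castAdd n 0) <;>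
      by_cases hw : F.conn w.1 = F.output (Fin.castAdd n 0)
    · exact Subtype.ext (F.conn_bijective.1 (hv.trans hw.symm))
    · rw [e₁ v hv, e₂ w hw] at h
      exact (w.2 (F.conn_bijective.1 h).symm).elim
    · rw [e₂ v hv, e₁ w hw] at h
      exact (v.2 (F.conn_bijective.1 h)).elim
    · rw [e₂ v hv, e₂ w hw] at h
      exact Subtype.ext (F.conn_bijective.1 h)
  · intro w
    obtain ⟨v, hv⟩ := F.conn_bijective.2 w.1
    by_cases h : v = F.input (Fin.castAdd m 0)
    · obtain ⟨u, hu⟩ := F.conn_bijective.2 (F.output (Fin.castAdd n 0))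
      have hne : u ≠ F.input (Fin.castAdd m 0) := fun h' =>
        w.2 (by rw [← hv, h, ← h', hu])
      exact ⟨⟨u, hne⟩, Subtype.ext ((e₁ ⟨u, hne⟩ hu).trans (h ▸ hv))⟩
    · refine ⟨⟨v, h⟩, Subtype.ext ((e₂ ⟨v, h⟩ ?_).trans hv)⟩
      exact fun h' => w.2 (hv.symm.trans h')

/-- The trace of one wire: the first input and the first output are deleted. -/
noncomputable def trace₁ (F : Hyp S (1 + m) (1 + n)) : Hyp S m n where
  vt := {v : F.vt // v ≠ F.input (Fin.castAdd m 0)}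
  vs := {v : F.vs // v ≠ F.output (Fin.castAdd n 0)}
  E := F.E
  vtFintype := Fintype.ofFinite _
  vtOrder := inferInstance
  vsFintype := Fintype.ofFinite _
  vsOrder := inferInstance
  edgeFintype := inferInstance
  left v := F.left v.1
  right v := F.right v.1
  conn := traceConn F
  conn_bijective := traceConn_bijective F
  label := F.label
  dom_label e := by
    rw [LinearHypergraph.length_sources]
    refine (F.dom_label e).trans (card_sub_of _ (fun v => F.right v = some e) _ ?_
      (fun _ => Iff.rfl) (F.length_sources e)).symm
    rintro _ hv rfl
    simp [right_output] at hv
  cod_label e := by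
    rw [LinearHypergraph.length_targets]
    refine (F.cod_label e).trans (card_sub_of _ (fun v => F.left v = some e) _ ?_
      (fun _ => Iff.rfl) (F.length_targets e)).symm
    rintro _ hv rfl
    simp [left_input] at hv
  card_inputs := by
    rw [LinearHypergraph.card_inputs_eq]
    refine card_remove (fun v => F.left v = none) _ (F.left_input (Fin.castAdd m 0)) ?_
    rw [← LinearHypergraph.card_inputs_eq, F.card_inputs]
  card_outputs := by
    rw [LinearHypergraph.card_outputs_eq]
    refine card_remove (fun v => F.right v = none) _ (F.right_output (Fin.castAdd n 0)) ?_
    rw [← LinearHypergraph.card_outputs_eq, F.card_outputs]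

/-- The trace of the first `x` wires, one wire at a time. -/
noncomputable def trace : (x : ℕ) → {m n : ℕ} → Hyp S (x + m) (x + n) → Hyp S m n
  | 0, m, n, F => F.cast (Nat.zero_add m) (Nat.zero_add n)
  | x + 1, m, n, F => trace₁ (trace x (F.cast (Nat.add_assoc x 1 m) (Nat.add_assoc x 1 n)))

/-- The composite swap of `m` wires with one wire. -/
noncomputable def swapLeft (S : Signature.{u}) : (m : ℕ) → Hyp S (m + 1) (1 + m)
  | 0 => (id S 1).cast (by omega) (by omega)
  | 1 => swap₁₁ S
  | m + 2 =>
    (((id S (m + 1)).tensor (swap₁₁ S)).seq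
      (((swapLeft S (m + 1)).tensor (id S 1)).cast (by omega) rfl)).cast (by omega) (by omega)

/-- The composite swap of one wire with `n` wires. -/
noncomputable def swapRight (S : Signature.{u}) : (n : ℕ) → Hyp S (1 + n) (n + 1)
  | 0 => (id S 1).cast (by omega) (by omega)
  | 1 => swap₁₁ S
  | n + 2 =>
    (((swapRight S (n + 1)).tensor (id S 1)).seq
      (((id S (n + 1)).tensor (swap₁₁ S)).cast (by omega) rfl)).cast (by omega) (by omega)

/-- The composite swap of `m` wires with `n` wires. -/
noncomputable def swap (S : Signature.{u}) : (m n : ℕ) → Hyp S (m + n) (n + m)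
  | 0, n => (id S n).cast (by omega) (by omega)
  | m + 1, 0 => (id S (m + 1)).cast (by omega) (by omega)
  | 1, n + 1 => swapRight S (n + 1)
  | m + 2, 1 => swapLeft S (m + 2)
  | m + 2, n + 2 =>
    (((((id S (m + 1)).tensor (swapRight S (n + 1))).tensor (id S 1)).seq
      (((swap S (m + 1) (n + 1)).tensor (swap₁₁ S)).cast (by omega) rfl)).seq
      ((((id S (n + 1)).tensor (swapLeft S (m + 1))).tensor (id S 1)).cast
        (by omega) rfl)).cast (by omega) (by omega)

end Hyp

/-! ### Terms and the equational theory of symmetric traced monoidal categories -/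

/-- Terms of type `m → n` of the traced PROP freely generated over a signature. -/
inductive Term (S : Signature.{u}) : ℕ → ℕ → Type u
  | gen (φ : S.Label) : Term S (S.dom φ) (S.cod φ)
  | id (n : ℕ) : Term S n n
  | swap (m n : ℕ) : Term S (m + n) (n + m)
  | seq {m n p : ℕ} (f : Term S m n) (g : Term S n p) : Term S m p
  | tensor {m n p q : ℕ} (f : Term S m n) (g : Term S p q) : Term S (m + p) (n + q)
  | trace (x : ℕ) {m n : ℕ} (f : Term S (x + m) (x + n)) : Term S m n

namespace Term

variable {S : Signature.{u}}

/-- The same term, with its type rewritten along equalities of numbers. The tensor of objects of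
a PROP is strictly associative and unital; this records it where Lean needs it. -/
def cast {m n m' n' : ℕ} (hm : m = m') (hn : n = n') (f : Term S m n) : Term S m' n' :=
  hm ▸ hn ▸ f

/-- Equality of terms under the equational theory of (strict) symmetric traced monoidal
categories: the least congruence containing the axioms. -/
inductive StmcEq : {m n : ℕ} → Term S m n → Term S m n → Prop
  -- congruence
  | refl {m n : ℕ} (f : Term S m n) : StmcEq f f
  | symm {m n : ℕ} {f g : Term S m n} : StmcEq f g → StmcEq g f
  | trans {m n : ℕ} {f g h : Term S m n} : StmcEq f g → StmcEq g h → StmcEq f h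
  | seq_congr {m n p : ℕ} {f f' : Term S m n} {g g' : Term S n p} :
      StmcEq f f' → StmcEq g g' → StmcEq (f.seq g) (f'.seq g')
  | tensor_congr {m n p q : ℕ} {f f' : Term S m n} {g g' : Term S p q} :
      StmcEq f f' → StmcEq g g' → StmcEq (f.tensor g) (f'.tensor g')
  | trace_congr (x : ℕ) {m n : ℕ} {f f' : Term S (x + m) (x + n)} :
      StmcEq f f' → StmcEq (trace x f) (trace x f')
  -- category
  | id_seq {m n : ℕ} (f : Term S m n) : StmcEq ((id m).seq f) f
  | seq_id {m n : ℕ} (f : Term S m n) : StmcEq (f.seq (id n)) f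
  | seq_assoc {m n p q : ℕ} (f : Term S m n) (g : Term S n p) (h : Term S p q) :
      StmcEq ((f.seq g).seq h) (f.seq (g.seq h))
  -- strict monoidal category
  | tensor_id (m n : ℕ) : StmcEq ((id m).tensor (id n)) (id (m + n))
  | interchange {m n p r s t : ℕ} (f : Term S m n) (g : Term S r s) (h : Term S n p)
      (k : Term S s t) :
      StmcEq ((f.tensor g).seq (h.tensor k)) ((f.seq h).tensor (g.seq k))
  | unit_tensor {m n : ℕ} (f : Term S m n) :
      StmcEq (((id 0).tensor f).cast (Nat.zero_add m) (Nat.zero_add n)) f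
  | tensor_unit {m n : ℕ} (f : Term S m n) :
      StmcEq ((f.tensor (id 0)).cast (Nat.add_zero m) (Nat.add_zero n)) f
  | tensor_assoc {m n p q r s : ℕ} (f : Term S m n) (g : Term S p q) (h : Term S r s) :
      StmcEq (((f.tensor g).tensor h).cast (Nat.add_assoc m p r) (Nat.add_assoc n q s))
        (f.tensor (g.tensor h))
  -- symmetry
  | swap_natural {m n p q : ℕ} (f : Term S m n) (g : Term S p q) :
      StmcEq ((f.tensor g).seq (swap n q)) ((swap m p).seq (g.tensor f))
  | swap_swap (m n : ℕ) : StmcEq ((swap m n).seq (swap n m)) (id (m + n))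
  | hexagon (m n p : ℕ) :
      StmcEq
        ((((swap m n).tensor (id p)).cast (Nat.add_assoc m n p) (Nat.add_assoc n m p)).seq
          (((id n).tensor (swap m p)).cast rfl (Nat.add_assoc n p m).symm))
        (swap m (n + p))
  | hexagon' (m n p : ℕ) :
      StmcEq
        ((((id m).tensor (swap n p)).cast (Nat.add_assoc m n p).symm (Nat.add_assoc m p n).symm).seq
          (((swap m p).tensor (id n)).cast rfl (Nat.add_assoc p m n)))
        (swap (m + n) p)
  -- trace
  | tightening (x : ℕ) {m n p q : ℕ} (g : Term S p m) (f : Term S (x + m) (x + n))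
      (h : Term S n q) :
      StmcEq (trace x ((((id x).tensor g).seq f).seq ((id x).tensor h)))
        ((g.seq (trace x f)).seq h)
  | sliding (x y : ℕ) {m n : ℕ} (f : Term S (x + m) (y + n)) (g : Term S y x) :
      StmcEq (trace x (f.seq (g.tensor (id n)))) (trace y ((g.tensor (id m)).seq f))
  | vanishing_zero {m n : ℕ} (f : Term S (0 + m) (0 + n)) :
      StmcEq (trace 0 f) (f.cast (Nat.zero_add m) (Nat.zero_add n))
  | vanishing_add (x y : ℕ) {m n : ℕ} (f : Term S (x + y + m) (x + y + n)) :
      StmcEq (trace (x + y) f)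
        (trace y (trace x (f.cast (Nat.add_assoc x y m) (Nat.add_assoc x y n))))
  | superposing (x : ℕ) {m n p q : ℕ} (f : Term S (x + m) (x + n)) (g : Term S p q) :
      StmcEq (trace x ((f.tensor g).cast (Nat.add_assoc x m p) (Nat.add_assoc x n q)))
        ((trace x f).tensor g)
  | yanking (x : ℕ) : StmcEq (trace x (swap x x)) (id x)
  | exchange (x y : ℕ) {m n : ℕ} (f : Term S (x + y + m) (x + y + n)) :
      StmcEq (trace y (trace x (f.cast (Nat.add_assoc x y m) (Nat.add_assoc x y n))))
        (trace x (trace y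
          (((((swap y x).tensor (id m)).seq f).seq ((swap x y).tensor (id n))).cast
            (Nat.add_assoc y x m) (Nat.add_assoc y x n))))

/-- The interpretation of terms as linear hypergraphs. -/
noncomputable def interp : {m n : ℕ} → Term S m n → Hyp S m n
  | _, _, gen φ => Hyp.gen φ
  | _, _, id n => Hyp.id S n
  | _, _, swap m n => Hyp.swap S m n
  | _, _, seq f g => f.interp.seq g.interp
  | _, _, tensor f g => f.interp.tensor g.interp
  | _, _, trace x f => Hyp.trace x f.interp

end Term

/-! Isomorphisms between the interpretations of the two sides of each axiom are never built by hand.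
Instead a hypergraph is replaced by the constraint it puts on colours of its wires. Since `conn`
matches target vertices with source vertices, a wire is a source vertex, and a colouring in a set
`W` is a function on source vertices. It shows a list of colours at the inputs, at the outputs, and
at the targets and sources of every edge. The denotation records the labelled edges and, for each
`W`, which families of lists arise in this way.

The denotation is compositional: sequencing becomes composition of relations, tensor becomes
concatenation of lists, and trace becomes "there is a list of colours common to the first inputs and
the first outputs" (`Hyp.den_seq`, `Hyp.den_tensor`, `Hyp.den_trace`). Every axiom then reduces to
elementary facts about concatenation and existential quantifiers, up to a renaming of edges
(`Term.StmcEq.den_equivalent`).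

The denotation also determines the hypergraph up to isomorphism
(`LabelledLinearHypergraph.isomorphic_of_equivalent`). Giving each wire of `F` its own colour
produces lists that `G` must also be able to show, hence a map from the wires of `G` to those of
`F`. It is onto because every wire ends at an output or at a source of an edge, so that its colour
is visible. The symmetric argument and finiteness make the map bijective, and the equality of the
lists says that it respects all the structure.

Only nonempty colour sets are compared: a hypergraph trace discards a closed loop, whereas the
relational trace still asks for a colour of it. -/

/-! ### Sorted enumerations of subsets -/

open Classical in
/-- The increasing enumeration of the elements satisfying `p`. -/
noncomputable def sortFilter {α : Type} [Fintype α] [LinearOrder α] (p : α → Prop) : List α :=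
  (Finset.univ.filter p).sort (· ≤ ·)

section sortFilter

variable {α β : Type} [Fintype α] [LinearOrder α] [Fintype β] [LinearOrder β]

theorem mem_sortFilter {p : α → Prop} {v : α} : v ∈ sortFilter p ↔ p v := by
  simp [sortFilter]

theorem sortedLT_sortFilter (p : α → Prop) : (sortFilter p).SortedLT :=
  Finset.sortedLT_sort _

theorem sortFilter_eq {p : α → Prop} {l : List α} (hl : l.SortedLT) (h : ∀ v, v ∈ l ↔ p v) :
    sortFilter p = l :=
  (sortedLT_sortFilter p).eq_of_mem_iff hl fun v => mem_sortFilter.trans (h v).symm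

theorem sortFilter_congr {p q : α → Prop} (h : ∀ v, p v ↔ q v) : sortFilter p = sortFilter q := by
  rw [funext fun v => propext (h v)]

theorem sortFilter_false {p : α → Prop} (h : ∀ v, ¬ p v) : sortFilter p = [] :=
  sortFilter_eq List.Pairwise.nil.sortedLT fun v => by simp [h]

/-- Everything on the left precedes everything on the right in the lexicographic order. The
`Fintype` instance is left arbitrary so that the lemma applies to whichever one a hypergraph
construction carries, including `Fintype.ofFinite`. -/
theorem sortFilter_lexSum {_ : Fintype (α ⊕ₗ β)} (p : α ⊕ₗ β → Prop) :
    sortFilter p = (sortFilter fun a => p (Sum.inlₗ a)).map Sum.inlₗ ++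
      (sortFilter fun b => p (Sum.inrₗ b)).map Sum.inrₗ := by
  refine sortFilter_eq (List.Pairwise.sortedLT (List.pairwise_append.2 ⟨?_, ?_, ?_⟩)) ?_
  · exact List.pairwise_map.2
      ((sortedLT_sortFilter _).pairwise.imp fun h => Sum.Lex.inl_lt_inl_iff.2 h)
  · exact List.pairwise_map.2
      ((sortedLT_sortFilter _).pairwise.imp fun h => Sum.Lex.inr_lt_inr_iff.2 h)
  · simp only [List.mem_map]
    rintro _ ⟨a, -, rfl⟩ _ ⟨b, -, rfl⟩
    exact Sum.Lex.inl_lt_inr a b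
  · rintro (v | v)
    · change Sum.inlₗ v ∈ _ ↔ p (Sum.inlₗ v)
      simp [mem_sortFilter]
    · change Sum.inrₗ v ∈ _ ↔ p (Sum.inrₗ v)
      simp [mem_sortFilter]

variable {W : Type}

theorem map_sortFilter_lexSum {_ : Fintype (α ⊕ₗ β)} {p : α ⊕ₗ β → Prop} {q : α → Prop}
    {r : β → Prop} (hq : ∀ a, p (Sum.inlₗ a) ↔ q a) (hr : ∀ b, p (Sum.inrₗ b) ↔ r b)
    (f : α ⊕ₗ β → W) : (sortFilter p).map f =
      (sortFilter q).map (fun a => f (Sum.inlₗ a)) ++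
        (sortFilter r).map fun b => f (Sum.inrₗ b) := by
  rw [sortFilter_lexSum, sortFilter_congr hq, sortFilter_congr hr, List.map_append, List.map_map,
    List.map_map]
  rfl

theorem map_sortFilter_inl {_ : Fintype (α ⊕ₗ β)} {p : α ⊕ₗ β → Prop} {q : α → Prop}
    (hq : ∀ a, p (Sum.inlₗ a) ↔ q a) (hr : ∀ b, ¬ p (Sum.inrₗ b)) (f : α ⊕ₗ β → W) :
    (sortFilter p).map f = (sortFilter q).map (fun a => f (Sum.inlₗ a)) := by
  rw [map_sortFilter_lexSum hq (fun _ => Iff.rfl), sortFilter_false hr, List.map_nil,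
    List.append_nil]

theorem map_sortFilter_inr {_ : Fintype (α ⊕ₗ β)} {p : α ⊕ₗ β → Prop} {r : β → Prop}
    (hq : ∀ a, ¬ p (Sum.inlₗ a)) (hr : ∀ b, p (Sum.inrₗ b) ↔ r b) (f : α ⊕ₗ β → W) :
    (sortFilter p).map f = (sortFilter r).map (fun b => f (Sum.inrₗ b)) := by
  rw [map_sortFilter_lexSum (fun _ => Iff.rfl) hr, sortFilter_false hq, List.map_nil,
    List.nil_append]

/-- For edge ends: composition and trace delete only interface vertices, so the sources and targets
of edges are unaffected. -/
theorem map_sortFilter_subtype {r p : α → Prop} {_ : Fintype {v // r v}} {p' : {v // r v} → Prop}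
    (h : ∀ v, p v → r v) (hp : ∀ v, p' v ↔ p v.1) {f' : {v // r v} → W} {f : α → W}
    (hf : ∀ v, f' v = f v.1) : (sortFilter p').map f' = (sortFilter p).map f := by
  have hv : (sortFilter p').map Subtype.val = sortFilter p := by
    refine (sortFilter_eq (List.Pairwise.sortedLT ?_) ?_).symm
    · exact List.pairwise_map.2 ((sortedLT_sortFilter _).pairwise.imp fun h => h)
    · intro v
      simp only [List.mem_map, mem_sortFilter, hp]
      exact ⟨fun ⟨w, hw, hv⟩ => hv ▸ hw, fun hv => ⟨⟨v, h v hv⟩, hv, rfl⟩⟩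
  rw [← hv, List.map_map]
  exact congrArg (fun g => (sortFilter p').map g) (funext hf)

/-- For the interface of a one-wire trace: deleting the least input or output removes the head of
the list. -/
theorem map_sortFilter_cons {p : α → Prop} {v₀ : α} (h₀ : p v₀)
    (hmin : ∀ v, p v → v ≠ v₀ → v₀ < v) {_ : Fintype {v // v ≠ v₀}} {p' : {v // v ≠ v₀} → Prop}
    (hp : ∀ v, p' v ↔ p v.1) {f' : {v // v ≠ v₀} → W} {f : α → W} (hf : ∀ v, f' v = f v.1) :
    (sortFilter p).map f = f v₀ :: (sortFilter p').map f' := by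
  have hv : sortFilter p = v₀ :: (sortFilter p').map Subtype.val := by
    refine sortFilter_eq (List.Pairwise.sortedLT (List.pairwise_cons.2 ⟨?_, ?_⟩)) fun v => ?_
    · simp only [List.mem_map, mem_sortFilter, hp]
      rintro _ ⟨w, hw, rfl⟩
      exact hmin w.1 hw w.2
    · exact List.pairwise_map.2 ((sortedLT_sortFilter _).pairwise.imp fun h => h)
    · simp only [List.mem_cons, List.mem_map, mem_sortFilter, hp]
      constructor
      · rintro (rfl | ⟨w, hw, rfl⟩)
        exacts [h₀, hw]
      · intro h
        by_cases hv : v = v₀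
        exacts [Or.inl hv, Or.inr ⟨⟨v, hv⟩, h, rfl⟩]
  rw [hv, List.map_cons, List.map_map, funext hf]
  rfl

theorem map_sortFilter_fin {n : ℕ} {_ : Fintype (Fin n)} {p : Fin n → Prop} (h : ∀ v, p v)
    (f : Fin n → W) : (sortFilter p).map f = List.ofFn f := by
  rw [sortFilter_eq (List.sortedLT_finRange n) (fun v => by simp [h]), List.ofFn_eq_map]

end sortFilter

/-! ### Colourings of a hypergraph -/

namespace LinearHypergraph

theorem sort_inputs (H : LinearHypergraph) :
    H.inputs.sort (· ≤ ·) = sortFilter fun v => H.left v = none := by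
  unfold inputs sortFilter
  congr!

theorem sort_outputs (H : LinearHypergraph) :
    H.outputs.sort (· ≤ ·) = sortFilter fun v => H.right v = none := by
  unfold outputs sortFilter
  congr!

theorem sources_eq (H : LinearHypergraph) (e : H.E) :
    H.sources e = sortFilter fun v => H.right v = some e := by
  unfold sources sortFilter
  congr!

theorem targets_eq (H : LinearHypergraph) (e : H.E) :
    H.targets e = sortFilter fun v => H.left v = some e := by
  unfold targets sortFilter
  congr!

theorem map_sources (H : LinearHypergraph) {W : Type} (f : H.vs → W) (e : H.E) :
    (H.sources e).map f = (sortFilter fun v => H.right v = some e).map f := by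
  rw [sources_eq]

theorem map_targets (H : LinearHypergraph) {W : Type} (f : H.vt → W) (e : H.E) :
    (H.targets e).map f = (sortFilter fun v => H.left v = some e).map f := by
  rw [targets_eq]

/-- A colouring `c` of the wires of `H` shows the colours `a` at the inputs, `b` at the outputs,
`t` at the targets and `s` at the sources of the edges. -/
structure IsColouring (H : LinearHypergraph) {W : Type} (c : H.vs → W) (a b : List W)
    (t s : H.E → List W) : Prop where
  inputs : (H.inputs.sort (· ≤ ·)).map (fun v => c (H.conn v)) = a
  outputs : (H.outputs.sort (· ≤ ·)).map c = b
  targets : ∀ e, (H.targets e).map (fun v => c (H.conn v)) = t e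
  sources : ∀ e, (H.sources e).map c = s e

end LinearHypergraph

/-- A relational denotation: labelled edges, together with a relation between the lists of colours
visible at the inputs, at the outputs, and at the targets and the sources of the edges. -/
structure Den (S : Signature.{u}) where
  E : Type
  label : E → S.Label
  rel : (W : Type) → List W → List W → (E → List W) → (E → List W) → Prop

/-! ### Operations on relational denotations -/

namespace Den

variable {S : Signature.{u}}

/-- Denotations agree up to a renaming of edges. -/
def Equivalent (D D' : Den S) : Prop :=
  ∃ ε : D.E ≃ D'.E, (∀ e, D'.label (ε e) = D.label e) ∧
    ∀ (W : Type) [Nonempty W] a b t s, D.rel W a b (t ∘ ε) (s ∘ ε) ↔ D'.rel W a b t s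

/-- The edgeless denotation of a relation between lists. -/
def edgeless (S : Signature.{u}) (R : (W : Type) → List W → List W → Prop) : Den S where
  E := Empty
  label e := e.elim
  rel W a b _ _ := R W a b

def id (S : Signature.{u}) (n : ℕ) : Den S :=
  edgeless S fun _ a b => a.length = n ∧ a = b

def swap (S : Signature.{u}) (m n : ℕ) : Den S :=
  edgeless S fun _ a b => ∃ u v, u.length = m ∧ v.length = n ∧ a = u ++ v ∧ b = v ++ u

/-- The lists `t` and `s` are arbitrary, so the arity and coarity have to be imposed separately. -/
def gen (φ : S.Label) : Den S where
  E := Unit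
  label _ := φ
  rel _ a b t s := a.length = S.dom φ ∧ b.length = S.cod φ ∧ a = s () ∧ b = t ()

def seq (D D' : Den S) : Den S where
  E := D.E ⊕ D'.E
  label := Sum.elim D.label D'.label
  rel W a b t s := ∃ c, D.rel W a c (t ∘ Sum.inl) (s ∘ Sum.inl) ∧
    D'.rel W c b (t ∘ Sum.inr) (s ∘ Sum.inr)

def tensor (D D' : Den S) : Den S where
  E := D.E ⊕ D'.E
  label := Sum.elim D.label D'.label
  rel W a b t s := ∃ a₁ a₂ b₁ b₂, a = a₁ ++ a₂ ∧ b = b₁ ++ b₂ ∧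
    D.rel W a₁ b₁ (t ∘ Sum.inl) (s ∘ Sum.inl) ∧ D'.rel W a₂ b₂ (t ∘ Sum.inr) (s ∘ Sum.inr)

def trace (x : ℕ) (D : Den S) : Den S where
  E := D.E
  label := D.label
  rel W a b t s := ∃ c, c.length = x ∧ D.rel W (c ++ a) (c ++ b) t s

theorem Equivalent.refl (D : Den S) : D.Equivalent D :=
  ⟨Equiv.refl _, fun _ => rfl, fun _ _ _ _ _ _ => Iff.rfl⟩

theorem Equivalent.symm {D D' : Den S} : D.Equivalent D' → D'.Equivalent D := by
  rintro ⟨ε, hl, hr⟩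
  refine ⟨ε.symm, fun e => by rw [← hl, ε.apply_symm_apply], fun W _ a b t s => ?_⟩
  rw [← hr W a b, Function.comp_assoc, Function.comp_assoc, ε.symm_comp_self]
  rfl

theorem Equivalent.trans {D₁ D₂ D₃ : Den S} :
    D₁.Equivalent D₂ → D₂.Equivalent D₃ → D₁.Equivalent D₃ := by
  rintro ⟨ε, hl, hr⟩ ⟨ε', hl', hr'⟩
  exact ⟨ε.trans ε', fun e => (hl' _).trans (hl e), fun W _ a b t s =>
    (hr W a b (t ∘ ε') (s ∘ ε')).trans (hr' W a b t s)⟩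

theorem Equivalent.seq {D₁ D₂ D₁' D₂' : Den S} :
    D₁.Equivalent D₁' → D₂.Equivalent D₂' → (D₁.seq D₂).Equivalent (D₁'.seq D₂') := by
  rintro ⟨ε, hl, hr⟩ ⟨ε', hl', hr'⟩
  refine ⟨Equiv.sumCongr ε ε', ?_, fun W _ a b t s => exists_congr fun c =>
    and_congr (hr W _ _ (t ∘ Sum.inl) (s ∘ Sum.inl)) (hr' W _ _ (t ∘ Sum.inr) (s ∘ Sum.inr))⟩
  rintro (e | e)
  exacts [hl e, hl' e]

theorem Equivalent.tensor {D₁ D₂ D₁' D₂' : Den S} :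
    D₁.Equivalent D₁' → D₂.Equivalent D₂' → (D₁.tensor D₂).Equivalent (D₁'.tensor D₂') := by
  rintro ⟨ε, hl, hr⟩ ⟨ε', hl', hr'⟩
  refine ⟨Equiv.sumCongr ε ε', ?_, fun W _ a b t s => exists₄_congr fun a₁ a₂ b₁ b₂ =>
    and_congr_right fun _ => and_congr_right fun _ =>
      and_congr (hr W _ _ (t ∘ Sum.inl) (s ∘ Sum.inl)) (hr' W _ _ (t ∘ Sum.inr) (s ∘ Sum.inr))⟩
  rintro (e | e)
  exacts [hl e, hl' e]

theorem Equivalent.trace (x : ℕ) {D D' : Den S} :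
    D.Equivalent D' → (D.trace x).Equivalent (D'.trace x) := by
  rintro ⟨ε, hl, hr⟩
  exact ⟨ε, hl, fun W _ a b t s => exists_congr fun c =>
    and_congr_right fun _ => hr W _ _ _ _⟩

/-- Serves the purely structural axioms, where there are no edges to rename. -/
theorem Equivalent.of_rel_iff {D D' : Den S} [IsEmpty D.E] [IsEmpty D'.E]
    (h : ∀ (W : Type) a b t s t' s', D.rel W a b t s ↔ D'.rel W a b t' s') : D.Equivalent D' :=
  ⟨Equiv.equivOfIsEmpty _ _, fun e => isEmptyElim e, fun W _ _ _ _ _ => h W _ _ _ _ _ _⟩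

theorem vanishing_zero (D : Den S) : (D.trace 0).Equivalent D := by
  refine ⟨Equiv.refl _, fun _ => rfl, fun W _ a b t s => ⟨?_, fun h => ⟨[], rfl, h⟩⟩⟩
  rintro ⟨c, hc, h⟩
  rw [List.length_eq_zero_iff] at hc
  subst hc
  exact h

theorem vanishing_add (x y : ℕ) (D : Den S) :
    (D.trace (x + y)).Equivalent ((D.trace x).trace y) := by
  refine ⟨Equiv.refl _, fun _ => rfl, fun W _ a b t s => ⟨?_, ?_⟩⟩
  · rintro ⟨c, hc, h⟩
    -- The inner trace binds the first `x` wires, the outer one the next `y`.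
    refine ⟨c.drop x, by simp [hc], c.take x, by simp [hc], ?_⟩
    rw [← List.append_assoc, ← List.append_assoc, List.take_append_drop]
    exact h
  · rintro ⟨c, hc, d, hd, h⟩
    refine ⟨d ++ c, by simp [hc, hd], ?_⟩
    rw [List.append_assoc, List.append_assoc]
    exact h

end Den

/-! ### Recovering a hypergraph from its denotation -/

namespace LinearHypergraph

variable (H : LinearHypergraph)

/-- No wire is hidden, because `right` is total. Hence a colouring is determined by the lists it
shows. -/
theorem mem_outputs_or_sources (v : H.vs) :
    v ∈ H.outputs.sort (· ≤ ·) ∨ ∃ e, v ∈ H.sources e := by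
  simp only [sort_outputs, sources_eq, mem_sortFilter]
  cases h : H.right v <;> simp

end LinearHypergraph

namespace LabelledLinearHypergraph

variable {S : Signature.{u}}

/-- The relational denotation of a hypergraph. -/
def den (F : LabelledLinearHypergraph S) : Den S where
  E := F.E
  label := F.label
  rel _ a b t s := ∃ c, F.IsColouring c a b t s

/-- Colour the wires of `F` by themselves, and compare with a colouring of `G`. -/
theorem exists_surjective_of_equivalent {F G : LabelledLinearHypergraph S}
    (ε : F.E ≃ G.E)
    (h : ∀ (W : Type) [Nonempty W] a b t s,
      F.den.rel W a b (t ∘ ε) (s ∘ ε) → G.den.rel W a b t s) :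
    ∃ d : G.vs → F.vs, Function.Surjective d ∧
      (G.inputs.sort (· ≤ ·)).map (fun v => d (G.conn v)) =
        (F.inputs.sort (· ≤ ·)).map F.conn ∧
      (G.outputs.sort (· ≤ ·)).map d = F.outputs.sort (· ≤ ·) ∧
      (∀ e, (G.targets (ε e)).map (fun v => d (G.conn v)) = (F.targets e).map F.conn) ∧
      (∀ e, (G.sources (ε e)).map d = F.sources e) := by
  -- `Option` makes the colour set nonempty even when `F` has no wires. The colouring of `F` is
  -- `some`, and `c` is a colouring of `G` showing the same lists.
  obtain ⟨c, hi, ho, ht, hs⟩ := h (Option F.vs)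
    ((F.inputs.sort (· ≤ ·)).map fun v => some (F.conn v)) ((F.outputs.sort (· ≤ ·)).map some)
    (fun e => (F.targets (ε.symm e)).map fun v => some (F.conn v))
    (fun e => (F.sources (ε.symm e)).map some)
    ⟨some, rfl, rfl, fun e => congrArg (fun e => (F.targets e).map fun v => some (F.conn v))
        (ε.symm_apply_apply e).symm,
      fun e => congrArg (fun e => (F.sources e).map some) (ε.symm_apply_apply e).symm⟩
  -- The spare colour `none` is never used: each wire of `G` is visible, and the visible colours are
  -- wires of `F`.
  have hc : ∀ v, ∃ w, c v = some w := by
    intro v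
    have key : ∀ (l : List G.vs) (l' : List F.vs), l.map c = l'.map some → v ∈ l →
        ∃ w, c v = some w := fun l l' h hv => by
      have := List.mem_map_of_mem (f := c) hv
      rw [h, List.mem_map] at this
      obtain ⟨w, -, hw⟩ := this
      exact ⟨w, hw.symm⟩
    obtain hv | ⟨e, hv⟩ := G.mem_outputs_or_sources v
    · exact key _ _ ho hv
    · exact key _ _ (hs e) hv
  choose d hd using hc
  obtain rfl : c = fun v => some (d v) := funext hd
  have inj := Function.Injective.list_map (Option.some_injective F.vs)
  have ho' : (G.outputs.sort (· ≤ ·)).map d = F.outputs.sort (· ≤ ·) :=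
    inj (by rw [← ho, List.map_map]; rfl)
  have hs' : ∀ e, (G.sources (ε e)).map d = F.sources e :=
    fun e => inj (by rw [List.map_map]; exact (hs (ε e)).trans (by rw [ε.symm_apply_apply]))
  refine ⟨d, fun v => ?_, inj ?_, ho', fun e => inj ?_, hs'⟩
  -- Surjectivity: each wire of `F` occurs in one of the lists of `F`, all of whose entries are
  -- values of `d`.
  · obtain hv | ⟨e, hv⟩ := F.mem_outputs_or_sources v
    · rw [← ho', List.mem_map] at hv
      obtain ⟨w, -, hw⟩ := hv
      exact ⟨w, hw⟩
    · rw [← hs', List.mem_map] at hv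
      obtain ⟨w, -, hw⟩ := hv
      exact ⟨w, hw⟩
  · rw [List.map_map, List.map_map]
    exact hi
  · rw [List.map_map, List.map_map]
    exact (ht (ε e)).trans (by rw [ε.symm_apply_apply]; rfl)

/-- The self-colouring of `F` supplies the map on wires. Its inverse acts on source vertices, and
transporting it along the two bijections `conn` gives the map on target vertices. -/
theorem isomorphic_of_equivalent {F G : LabelledLinearHypergraph S}
    (h : F.den.Equivalent G.den) : F.Isomorphic G := by
  obtain ⟨ε', -, h'⟩ := h.symm
  obtain ⟨ε, hl, h⟩ := h
  obtain ⟨d', hd', -⟩ := exists_surjective_of_equivalent (F := G) (G := F) ε'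
    fun W _ a b t s => (h' W a b t s).1
  obtain ⟨d, hd, hi, ho, ht, hs⟩ := exists_surjective_of_equivalent (F := F) (G := G) ε
    fun W _ a b t s => (h W a b t s).1
  -- The opposite surjection `d'` is needed only for the bound on cardinalities; it need not be
  -- inverse to `d`.
  have hb : Function.Bijective d := hd.bijective_of_nat_card_le
    (Nat.card_le_card_of_surjective d' hd')
  let δ := Equiv.ofBijective d hb
  let κ := Equiv.ofBijective F.conn F.conn_bijective
  let κ' := Equiv.ofBijective G.conn G.conn_bijective
  let τ : F.vt ≃ G.vt := (κ.trans δ.symm).trans κ'.symm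
  have hτ : ∀ v, d (G.conn (τ v)) = F.conn v := fun v => by
    change δ (κ' (κ'.symm (δ.symm (κ v)))) = _
    rw [κ'.apply_symm_apply, δ.apply_symm_apply]
    rfl
  have hsym : ∀ (l : List G.vs) (l' : List F.vs), l.map d = l' → l'.map δ.symm = l := by
    rintro l _ rfl
    rw [List.map_map]
    exact (congrArg (fun f => l.map f) (funext δ.symm_apply_apply)).trans l.map_id
  have htsym : ∀ (l : List G.vt) (l' : List F.vt),
      l.map (fun v => d (G.conn v)) = l'.map F.conn → l'.map τ = l := by
    intro l l' h
    refine (Function.Injective.list_map (hb.1.comp G.conn_bijective.1)) ?_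
    rw [List.map_map]
    exact (congrArg (fun f => l'.map f) (funext hτ)).trans h.symm
  refine ⟨⟨τ, δ.symm, ε, fun e => hsym _ _ (hs e), fun e => htsym _ _ (ht e), fun v => ?_, hl⟩,
    τ.bijective, δ.symm.bijective, ε.bijective, htsym _ _ hi, hsym _ _ ho⟩
  exact δ.injective ((δ.apply_symm_apply _).trans (hτ v).symm)

end LabelledLinearHypergraph

/-! ### The denotation of a sequential composite -/

namespace Hyp

variable {S : Signature.{u}} {m n p q : ℕ}

theorem sort_inputs_eq_ofFn (F : Hyp S m n) : F.inputs.sort (· ≤ ·) = List.ofFn F.input := by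
  rw [LinearHypergraph.sort_inputs]
  refine sortFilter_eq (List.sortedLT_ofFn_iff.2 (OrderEmbedding.strictMono _)) fun v => ?_
  rw [List.mem_ofFn]
  exact ⟨fun ⟨i, hi⟩ => hi ▸ F.left_input i, fun h => ⟨_, F.input_inputIdx v h⟩⟩

theorem sort_outputs_eq_ofFn (F : Hyp S m n) : F.outputs.sort (· ≤ ·) = List.ofFn F.output := by
  rw [LinearHypergraph.sort_outputs]
  refine sortFilter_eq (List.sortedLT_ofFn_iff.2 (OrderEmbedding.strictMono _)) fun v => ?_
  rw [List.mem_ofFn]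
  exact ⟨fun ⟨i, hi⟩ => hi ▸ F.right_output i, fun h => ⟨_, F.output_outputIdx v h⟩⟩

theorem outputIdx_output (F : Hyp S m n) (i : Fin n) (h : F.right (F.output i) = none) :
    F.outputIdx (F.output i) h = i :=
  F.output_injective (F.output_outputIdx _ h)

theorem seqConn_inl_of_eq_none (F : Hyp S m n) (G : Hyp S n p) (v : F.vt)
    (h : F.right (F.conn v) = none) : seqConn F G (Sum.inlₗ v) =
      Sum.inrₗ (G.conn (G.input (F.outputIdx (F.conn v) h))) :=
  dif_pos h

theorem seqConn_inl_of_ne_none (F : Hyp S m n) (G : Hyp S n p) (v : F.vt)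
    (h : F.right (F.conn v) ≠ none) : seqConn F G (Sum.inlₗ v) = Sum.inlₗ ⟨F.conn v, h⟩ :=
  dif_neg h

theorem length_of_isColouring (F : Hyp S m n) {W : Type} {c : F.vs → W} {a b t s}
    (h : F.IsColouring c a b t s) : a.length = m ∧ b.length = n := by
  constructor
  · rw [← h.inputs, List.length_map, Finset.length_sort, F.card_inputs]
  · rw [← h.outputs, List.length_map, Finset.length_sort, F.card_outputs]

section seq

variable (F : Hyp S m n) (G : Hyp S n p) {W : Type}

theorem map_inputs_seq (f : (F.seq G).vt → W) : ((F.seq G).inputs.sort (· ≤ ·)).map f =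
    (F.inputs.sort (· ≤ ·)).map fun v => f (Sum.inlₗ v) := by
  rw [LinearHypergraph.sort_inputs, LinearHypergraph.sort_inputs]
  classical
  exact map_sortFilter_inl (β := {v : G.vt // G.left v ≠ none}) (fun a => by simp [seq])
    (fun b => by simpa [seq] using b.2) _

theorem map_targets_seq_inl (f : (F.seq G).vt → W) (e : F.E) :
    ((F.seq G).targets (Sum.inl e)).map f = (F.targets e).map fun v => f (Sum.inlₗ v) := by
  refine ((F.seq G).map_targets f _).trans (Eq.trans ?_ (F.map_targets _ e).symm)
  classical
  exact map_sortFilter_inl (β := {v : G.vt // G.left v ≠ none}) (fun a => by simp [seq])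
    (fun b => by simp [seq]) _

theorem map_targets_seq_inr (f : (F.seq G).vt → W) (g : G.vt → W) (e : G.E)
    (h : ∀ v, f (Sum.inrₗ v) = g v.1) :
    ((F.seq G).targets (Sum.inr e)).map f = (G.targets e).map g := by
  refine ((F.seq G).map_targets f _).trans (Eq.trans ?_ (G.map_targets _ e).symm)
  classical
  refine (map_sortFilter_inr (β := {v : G.vt // G.left v ≠ none})
    (r := fun v => G.left v.1 = some e) (fun a => by simp [seq]) (fun b => by simp [seq]) _).trans ?_
  exact map_sortFilter_subtype (p := fun v => G.left v = some e) (fun v hv => by simp [hv])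
    (fun _ => Iff.rfl) h

theorem map_outputs_seq (f : (F.seq G).vs → W) : ((F.seq G).outputs.sort (· ≤ ·)).map f =
    (G.outputs.sort (· ≤ ·)).map fun v => f (Sum.inrₗ v) := by
  rw [LinearHypergraph.sort_outputs, LinearHypergraph.sort_outputs]
  classical
  exact map_sortFilter_inr (α := {v : F.vs // F.right v ≠ none})
    (fun b => by simpa [seq] using b.2) (fun a => by simp [seq]) _

theorem map_sources_seq_inr (f : (F.seq G).vs → W) (e : G.E) :
    ((F.seq G).sources (Sum.inr e)).map f = (G.sources e).map fun v => f (Sum.inrₗ v) := by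
  refine ((F.seq G).map_sources f _).trans (Eq.trans ?_ (G.map_sources _ e).symm)
  classical
  exact map_sortFilter_inr (α := {v : F.vs // F.right v ≠ none})
    (fun b => by simp [seq]) (fun a => by simp [seq]) _

theorem map_sources_seq_inl (f : (F.seq G).vs → W) (g : F.vs → W) (e : F.E)
    (h : ∀ v, f (Sum.inlₗ v) = g v.1) :
    ((F.seq G).sources (Sum.inl e)).map f = (F.sources e).map g := by
  refine ((F.seq G).map_sources f _).trans (Eq.trans ?_ (F.map_sources _ e).symm)
  classical
  refine (map_sortFilter_inl (α := {v : F.vs // F.right v ≠ none})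
    (q := fun v => F.right v.1 = some e) (fun a => by simp [seq]) (fun b => by simp [seq]) _).trans ?_
  exact map_sortFilter_subtype (p := fun v => F.right v = some e) (fun v hv => by simp [hv])
    (fun _ => Iff.rfl) h

/-- Colourings of a composite are pairs of colourings which agree on the middle wires. -/
theorem isColouring_seq_iff {a b : List W} {t s : (F.seq G).E → List W} {c : (F.seq G).vs → W}
    {c₁ : F.vs → W} {c₂ : G.vs → W} (h₁ : ∀ v, c (Sum.inlₗ v) = c₁ v.1)
    (h₂ : ∀ v, c (Sum.inrₗ v) = c₂ v) (h : ∀ i, c₁ (F.output i) = c₂ (G.conn (G.input i))) :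
    (F.seq G).IsColouring c a b t s ↔ ∃ d,
      F.IsColouring c₁ a d (t ∘ Sum.inl) (s ∘ Sum.inl) ∧
        G.IsColouring c₂ d b (t ∘ Sum.inr) (s ∘ Sum.inr) := by
  -- A vertex that led to an output of `F` is rewired into `G`; the agreement `h` says that this
  -- does not change its colour.
  have hl : ∀ v, c ((F.seq G).conn (Sum.inlₗ v)) = c₁ (F.conn v) := by
    intro v
    by_cases hv : F.right (F.conn v) = none
    · refine (congrArg c (seqConn_inl_of_eq_none F G v hv)).trans ((h₂ _).trans ?_)
      rw [← h, output_outputIdx]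
    · exact (congrArg c (seqConn_inl_of_ne_none F G v hv)).trans (h₁ _)
  have hr : ∀ v, c ((F.seq G).conn (Sum.inrₗ v)) = c₂ (G.conn v.1) := fun v => h₂ _
  have hmid : (F.outputs.sort (· ≤ ·)).map c₁ =
      (G.inputs.sort (· ≤ ·)).map fun v => c₂ (G.conn v) := by
    rw [sort_outputs_eq_ofFn, sort_inputs_eq_ofFn, List.map_ofFn, List.map_ofFn]
    exact congrArg List.ofFn (funext h)
  have ei := map_inputs_seq F G fun v => c ((F.seq G).conn v)
  have eo := map_outputs_seq F G c
  have et₁ := map_targets_seq_inl F G fun v => c ((F.seq G).conn v)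
  have et₂ := fun e => map_targets_seq_inr F G (fun v => c ((F.seq G).conn v))
    (fun v => c₂ (G.conn v)) e hr
  have es₁ := fun e => map_sources_seq_inl F G c _ e h₁
  have es₂ := map_sources_seq_inr F G c
  simp only [hl] at ei et₁
  simp only [h₂] at eo es₂
  constructor
  · rintro ⟨hi, ho, ht, hs⟩
    exact ⟨_, ⟨ei.symm.trans hi, rfl, fun e => (et₁ e).symm.trans (ht _),
      fun e => (es₁ e).symm.trans (hs _)⟩, hmid.symm, eo.symm.trans ho,
      fun e => (et₂ e).symm.trans (ht _), fun e => (es₂ e).symm.trans (hs _)⟩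
  · rintro ⟨d, ⟨hi, -, ht, hs⟩, -, ho, ht', hs'⟩
    refine ⟨ei.trans hi, eo.trans ho, ?_, ?_⟩
    · rintro (e | e)
      exacts [(et₁ e).trans (ht e), (et₂ e).trans (ht' e)]
    · rintro (e | e)
      exacts [(es₁ e).trans (hs e), (es₂ e).trans (hs' e)]

theorem den_seq : (F.seq G).den.Equivalent (F.den.seq G.den) := by
  classical
  refine ⟨Equiv.refl _, fun _ => rfl, fun W _ a b t s => ⟨?_, ?_⟩⟩
  · rintro ⟨c, hc⟩
    obtain ⟨d, h₁, h₂⟩ := (isColouring_seq_iff F G (c := c)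
      -- A deleted output of `F` receives the colour of the wire of `G` to which it is glued.
      (c₁ := fun v => if h : F.right v = none
        then c (Sum.inrₗ (G.conn (G.input (F.outputIdx v h)))) else c (Sum.inlₗ ⟨v, h⟩))
      (c₂ := fun v => c (Sum.inrₗ v)) (fun v => by rw [dif_neg v.2]) (fun _ => rfl)
      (fun i => by simp [right_output, outputIdx_output])).1 hc
    exact ⟨d, ⟨_, h₁⟩, ⟨_, h₂⟩⟩
  · rintro ⟨d, ⟨c₁, h₁⟩, ⟨c₂, h₂⟩⟩
    refine ⟨fun v => Sum.elim (fun v => c₁ v.1) c₂ (ofLex v), (isColouring_seq_iff F G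
      (c₁ := c₁) (c₂ := c₂) (fun _ => rfl) (fun _ => rfl) fun i => ?_).2 ⟨d, h₁, h₂⟩⟩
    -- Both colourings show the same middle list `d`, so they agree position by position.
    have := h₁.outputs.trans h₂.inputs.symm
    rw [sort_outputs_eq_ofFn, sort_inputs_eq_ofFn, List.map_ofFn, List.map_ofFn] at this
    exact congrFun (List.ofFn_injective this) i

end seq

end Hyp

/-! ### The denotations of tensors, traces and basic hypergraphs -/

namespace Hyp

variable {S : Signature.{u}} {m n p q : ℕ}

section tensor

variable (F : Hyp S m n) (G : Hyp S p q) {W : Type}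

theorem map_inputs_tensor (f : (F.tensor G).vt → W) :
    ((F.tensor G).inputs.sort (· ≤ ·)).map f =
      (F.inputs.sort (· ≤ ·)).map (fun v => f (Sum.inlₗ v)) ++
        (G.inputs.sort (· ≤ ·)).map fun v => f (Sum.inrₗ v) := by
  rw [LinearHypergraph.sort_inputs, LinearHypergraph.sort_inputs, LinearHypergraph.sort_inputs]
  exact map_sortFilter_lexSum (fun a => by simp [tensor]) (fun b => by simp [tensor]) _

theorem map_outputs_tensor (f : (F.tensor G).vs → W) :
    ((F.tensor G).outputs.sort (· ≤ ·)).map f =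
      (F.outputs.sort (· ≤ ·)).map (fun v => f (Sum.inlₗ v)) ++
        (G.outputs.sort (· ≤ ·)).map fun v => f (Sum.inrₗ v) := by
  rw [LinearHypergraph.sort_outputs, LinearHypergraph.sort_outputs, LinearHypergraph.sort_outputs]
  exact map_sortFilter_lexSum (fun a => by simp [tensor]) (fun b => by simp [tensor]) _

theorem map_targets_tensor_inl (f : (F.tensor G).vt → W) (e : F.E) :
    ((F.tensor G).targets (Sum.inl e)).map f =
      (F.targets e).map fun v => f (Sum.inlₗ v) := by
  refine ((F.tensor G).map_targets f _).trans (Eq.trans ?_ (F.map_targets _ e).symm)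
  exact map_sortFilter_inl (fun a => by simp [tensor]) (fun b => by simp [tensor]) _

theorem map_targets_tensor_inr (f : (F.tensor G).vt → W) (e : G.E) :
    ((F.tensor G).targets (Sum.inr e)).map f =
      (G.targets e).map fun v => f (Sum.inrₗ v) := by
  refine ((F.tensor G).map_targets f _).trans (Eq.trans ?_ (G.map_targets _ e).symm)
  exact map_sortFilter_inr (fun a => by simp [tensor]) (fun b => by simp [tensor]) _

theorem map_sources_tensor_inl (f : (F.tensor G).vs → W) (e : F.E) :
    ((F.tensor G).sources (Sum.inl e)).map f =
      (F.sources e).map fun v => f (Sum.inlₗ v) := by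
  refine ((F.tensor G).map_sources f _).trans (Eq.trans ?_ (F.map_sources _ e).symm)
  exact map_sortFilter_inl (fun a => by simp [tensor]) (fun b => by simp [tensor]) _

theorem map_sources_tensor_inr (f : (F.tensor G).vs → W) (e : G.E) :
    ((F.tensor G).sources (Sum.inr e)).map f =
      (G.sources e).map fun v => f (Sum.inrₗ v) := by
  refine ((F.tensor G).map_sources f _).trans (Eq.trans ?_ (G.map_sources _ e).symm)
  exact map_sortFilter_inr (fun a => by simp [tensor]) (fun b => by simp [tensor]) _

theorem den_tensor : (F.tensor G).den.Equivalent (F.den.tensor G.den) := by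
  refine ⟨Equiv.refl _, fun _ => rfl, fun W _ a b t s => ⟨?_, ?_⟩⟩
  · rintro ⟨c, hi, ho, ht, hs⟩
    rw [map_inputs_tensor] at hi
    rw [map_outputs_tensor] at ho
    exact ⟨_, _, _, _, hi.symm, ho.symm,
      ⟨fun v => c (Sum.inlₗ v), rfl, rfl,
        fun e => (map_targets_tensor_inl F G _ e).symm.trans (ht (Sum.inl e)),
        fun e => (map_sources_tensor_inl F G _ e).symm.trans (hs (Sum.inl e))⟩,
      ⟨fun v => c (Sum.inrₗ v), rfl, rfl,
        fun e => (map_targets_tensor_inr F G _ e).symm.trans (ht (Sum.inr e)),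
        fun e => (map_sources_tensor_inr F G _ e).symm.trans (hs (Sum.inr e))⟩⟩
  · rintro ⟨_, _, _, _, rfl, rfl, ⟨c₁, rfl, rfl, ht, hs⟩, ⟨c₂, rfl, rfl, ht', hs'⟩⟩
    refine ⟨fun v => Sum.elim c₁ c₂ (ofLex v), map_inputs_tensor F G _,
      map_outputs_tensor F G _, ?_, ?_⟩
    · rintro (e | e)
      exacts [(map_targets_tensor_inl F G _ e).trans (ht e),
        (map_targets_tensor_inr F G _ e).trans (ht' e)]
    · rintro (e | e)
      exacts [(map_sources_tensor_inl F G _ e).trans (hs e),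
        (map_sources_tensor_inr F G _ e).trans (hs' e)]

end tensor

section trace

variable (F : Hyp S (1 + m) (1 + n)) {W : Type}

theorem map_inputs_trace₁ {f' : (trace₁ F).vt → W} {f : F.vt → W}
    (h : ∀ v, f' v = f v.1) : (F.inputs.sort (· ≤ ·)).map f =
      f (F.input (Fin.castAdd m 0)) :: ((trace₁ F).inputs.sort (· ≤ ·)).map f' := by
  rw [LinearHypergraph.sort_inputs, LinearHypergraph.sort_inputs]
  refine map_sortFilter_cons (v₀ := F.input (Fin.castAdd m 0))
    (p' := fun v => F.left v.1 = none) (F.left_input _) ?_ (fun _ => Iff.rfl) h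
  intro v hv hne
  rw [← F.input_inputIdx v hv] at hne ⊢
  refine (F.inputs.orderEmbOfFin F.card_inputs).strictMono (Fin.lt_def.2 ?_)
  exact Nat.pos_of_ne_zero fun h => hne (congrArg F.input (Fin.ext h))

theorem map_outputs_trace₁ {f' : (trace₁ F).vs → W} {f : F.vs → W}
    (h : ∀ v, f' v = f v.1) : (F.outputs.sort (· ≤ ·)).map f =
      f (F.output (Fin.castAdd n 0)) :: ((trace₁ F).outputs.sort (· ≤ ·)).map f' := by
  rw [LinearHypergraph.sort_outputs, LinearHypergraph.sort_outputs]
  refine map_sortFilter_cons (v₀ := F.output (Fin.castAdd n 0))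
    (p' := fun v => F.right v.1 = none) (F.right_output _) ?_ (fun _ => Iff.rfl) h
  intro v hv hne
  rw [← F.output_outputIdx v hv] at hne ⊢
  refine (F.outputs.orderEmbOfFin F.card_outputs).strictMono (Fin.lt_def.2 ?_)
  exact Nat.pos_of_ne_zero fun h => hne (congrArg F.output (Fin.ext h))

theorem map_targets_trace₁ {f' : (trace₁ F).vt → W} {f : F.vt → W} (h : ∀ v, f' v = f v.1)
    (e : F.E) : ((trace₁ F).targets e).map f' = (F.targets e).map f := by
  refine ((trace₁ F).map_targets f' _).trans (Eq.trans ?_ (F.map_targets _ e).symm)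
  refine map_sortFilter_subtype (r := fun v => v ≠ F.input (Fin.castAdd m 0))
    (p := fun v => F.left v = some e) (p' := fun v => F.left v.1 = some e) ?_ (fun _ => Iff.rfl) h
  rintro _ hv rfl
  simp [left_input] at hv

theorem map_sources_trace₁ {f' : (trace₁ F).vs → W} {f : F.vs → W} (h : ∀ v, f' v = f v.1)
    (e : F.E) : ((trace₁ F).sources e).map f' = (F.sources e).map f := by
  refine ((trace₁ F).map_sources f' _).trans (Eq.trans ?_ (F.map_sources _ e).symm)
  refine map_sortFilter_subtype (r := fun v => v ≠ F.output (Fin.castAdd n 0))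
    (p := fun v => F.right v = some e) (p' := fun v => F.right v.1 = some e) ?_ (fun _ => Iff.rfl) h
  rintro _ hv rfl
  simp [right_output] at hv

/-- The trace joins the wire leaving the first input to the wire reaching the first output. If `d`
gives these the same colour, rewiring preserves colours, and both interface lists just lose that
colour as their head. -/
theorem isColouring_trace₁_iff {a b : List W} {t s : F.E → List W} {c : (trace₁ F).vs → W}
    {d : F.vs → W} (hc : ∀ v, c v = d v.1)
    (h : d (F.conn (F.input (Fin.castAdd m 0))) = d (F.output (Fin.castAdd n 0))) :
    (trace₁ F).IsColouring c a b t s ↔ F.IsColouring d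
      (d (F.output (Fin.castAdd n 0)) :: a) (d (F.output (Fin.castAdd n 0)) :: b) t s := by
  have hl : ∀ v, c ((trace₁ F).conn v) = d (F.conn v.1) := by
    intro v
    rw [hc]
    by_cases hv : F.conn v.1 = F.output (Fin.castAdd n 0)
    · rw [hv, ← h]
      exact congrArg (fun w : {w // w ≠ F.output (Fin.castAdd n 0)} => d w.1) (dif_pos hv)
    · exact congrArg (fun w : {w // w ≠ F.output (Fin.castAdd n 0)} => d w.1) (dif_neg hv)
  have ei := map_inputs_trace₁ F (f := fun v => d (F.conn v)) hl
  have eo := map_outputs_trace₁ F hc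
  have et := map_targets_trace₁ F (f := fun v => d (F.conn v)) hl
  have es := map_sources_trace₁ F hc
  rw [h] at ei
  constructor
  · rintro ⟨rfl, rfl, ht, hs⟩
    exact ⟨ei, eo, fun e => (et e).symm.trans (ht e), fun e => (es e).symm.trans (hs e)⟩
  · rintro ⟨hi, ho, ht, hs⟩
    exact ⟨(List.cons.inj (ei.symm.trans hi)).2, (List.cons.inj (eo.symm.trans ho)).2,
      fun e => (et e).trans (ht e), fun e => (es e).trans (hs e)⟩

/-- The delicate case is a first input connected directly to the first output. The trace deletes
this wire altogether, while the relation still quantifies over a colour for it; this is where `W`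
must be nonempty. -/
theorem den_trace₁ : (trace₁ F).den.Equivalent (F.den.trace 1) := by
  classical
  refine ⟨Equiv.refl _, fun _ => rfl, fun W _ a b t s => ⟨?_, ?_⟩⟩
  · rintro ⟨c, hc⟩
    -- The colour of the feedback wire: arbitrary for a closed loop, otherwise read off from the
    -- surviving wire that starts at the first input.
    let w : W := if h : F.conn (F.input (Fin.castAdd m 0)) = F.output (Fin.castAdd n 0)
      then Classical.arbitrary W else c ⟨_, h⟩
    refine ⟨[w], rfl, fun v => if h : v = F.output (Fin.castAdd n 0) then w else c ⟨v, h⟩, ?_⟩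
    refine Eq.mp ?_ ((isColouring_trace₁_iff F (c := c) (t := t) (s := s)
      (d := fun v => if h : v = F.output (Fin.castAdd n 0) then w else c ⟨v, h⟩)
      (fun v => by rw [dif_neg v.2]; rfl) ?_).1 hc)
    · rw [dif_pos rfl]
      rfl
    · by_cases h : F.conn (F.input (Fin.castAdd m 0)) = F.output (Fin.castAdd n 0)
      · simp [h]
      · simp [h, w]
  · rintro ⟨c, hl, d, hd⟩
    obtain ⟨w, rfl⟩ := List.length_eq_one_iff.1 hl
    have hi := (List.cons.inj ((map_inputs_trace₁ F (f := fun v => d (F.conn v))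
      fun _ => rfl).symm.trans hd.inputs)).1
    have ho := (List.cons.inj ((map_outputs_trace₁ F (f := d) fun _ => rfl).symm.trans
      hd.outputs)).1
    subst ho
    exact ⟨fun v => d v.1, (isColouring_trace₁_iff F (t := t) (s := s) (d := d)
      (fun _ => rfl) hi).2 hd⟩

/-- The recursion traces one further wire after the first `x`, which is relational vanishing with `y
= 1`. -/
theorem den_trace : ∀ (x : ℕ) {m n : ℕ} (F : Hyp S (x + m) (x + n)),
    (trace x F).den.Equivalent (F.den.trace x)
  | 0, _, _, _ => (Den.vanishing_zero _).symm
  | x + 1, _, _, _ => (den_trace₁ _).trans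
    (((den_trace x _).trace 1).trans (Den.vanishing_add x 1 _).symm)

end trace

theorem den_id (n : ℕ) : (id S n).den.Equivalent (Den.id S n) := by
  have hi : ∀ (W : Type) (f : Fin n → W),
      ((id S n).inputs.sort (· ≤ ·)).map f = List.ofFn f := fun W f => by
    rw [LinearHypergraph.sort_inputs]
    exact map_sortFilter_fin (fun _ => rfl) f
  have ho : ∀ (W : Type) (f : Fin n → W),
      ((id S n).outputs.sort (· ≤ ·)).map f = List.ofFn f := fun W f => by
    rw [LinearHypergraph.sort_outputs]
    exact map_sortFilter_fin (fun _ => rfl) f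
  refine ⟨Equiv.refl _, fun _ => rfl, fun W _ a b t s => ⟨?_, ?_⟩⟩
  · rintro ⟨c, rfl, rfl, -⟩
    exact ⟨by rw [List.length_map, Finset.length_sort, (id S n).card_inputs], rfl⟩
  · rintro ⟨rfl, rfl⟩
    exact ⟨a.get, (hi W _).trans (List.ofFn_get a), (ho W _).trans (List.ofFn_get a),
      fun e => e.elim, fun e => e.elim⟩

theorem den_swap₁₁ : (swap₁₁ S).den.Equivalent (Den.swap S 1 1) := by
  have hi : ∀ (W : Type) (f : Fin 2 → W),
      ((swap₁₁ S).inputs.sort (· ≤ ·)).map f = [f 0, f 1] := fun W f => by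
    rw [LinearHypergraph.sort_inputs]
    exact (map_sortFilter_fin (fun _ => rfl) f).trans (by simp)
  have ho : ∀ (W : Type) (f : Fin 2 → W),
      ((swap₁₁ S).outputs.sort (· ≤ ·)).map f = [f 0, f 1] := fun W f => by
    rw [LinearHypergraph.sort_outputs]
    exact (map_sortFilter_fin (fun _ => rfl) f).trans (by simp)
  refine ⟨Equiv.refl _, fun _ => rfl, fun W _ a b t s => ⟨?_, ?_⟩⟩
  · rintro ⟨c, rfl, rfl, -⟩
    -- Colours live on source vertices, so the first input shows the colour of vertex `1`.
    exact ⟨[c (1 : Fin 2)], [c (0 : Fin 2)], rfl, rfl, hi W _, ho W _⟩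
  · rintro ⟨u, v, hu, hv, rfl, rfl⟩
    obtain ⟨x, rfl⟩ := List.length_eq_one_iff.1 hu
    obtain ⟨y, rfl⟩ := List.length_eq_one_iff.1 hv
    exact ⟨(![y, x] : Fin 2 → W), hi W _, ho W _, fun e => e.elim, fun e => e.elim⟩

theorem den_gen (φ : S.Label) : (gen φ).den.Equivalent (Den.gen φ) := by
  have hi : ∀ (W : Type) (f : Fin (S.dom φ) ⊕ₗ Fin (S.cod φ) → W),
      ((gen φ).inputs.sort (· ≤ ·)).map f = List.ofFn fun i => f (Sum.inlₗ i) := fun W f => by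
    rw [LinearHypergraph.sort_inputs]
    exact (map_sortFilter_inl (q := fun _ => True) (fun _ => by simp [gen])
      (fun _ => by simp [gen]) f).trans (map_sortFilter_fin (fun _ => trivial) _)
  have ho : ∀ (W : Type) (f : Fin (S.dom φ) ⊕ₗ Fin (S.cod φ) → W),
      ((gen φ).outputs.sort (· ≤ ·)).map f = List.ofFn fun i => f (Sum.inrₗ i) := fun W f => by
    rw [LinearHypergraph.sort_outputs]
    exact (map_sortFilter_inr (r := fun _ => True) (fun _ => by simp [gen])
      (fun _ => by simp [gen]) f).trans (map_sortFilter_fin (fun _ => trivial) _)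
  have hs : ∀ (W : Type) (f : Fin (S.dom φ) ⊕ₗ Fin (S.cod φ) → W),
      ((gen φ).sources ()).map f = List.ofFn fun i => f (Sum.inlₗ i) := fun W f => by
    refine ((gen φ).map_sources f _).trans ?_
    exact (map_sortFilter_inl (q := fun _ => True) (fun _ => by simp [gen])
      (fun _ => by simp [gen]) f).trans (map_sortFilter_fin (fun _ => trivial) _)
  have ht : ∀ (W : Type) (f : Fin (S.dom φ) ⊕ₗ Fin (S.cod φ) → W),
      ((gen φ).targets ()).map f = List.ofFn fun i => f (Sum.inrₗ i) := fun W f => by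
    refine ((gen φ).map_targets f _).trans ?_
    exact (map_sortFilter_inr (r := fun _ => True) (fun _ => by simp [gen])
      (fun _ => by simp [gen]) f).trans (map_sortFilter_fin (fun _ => trivial) _)
  refine ⟨Equiv.refl _, fun _ => rfl, fun W _ a b t s => ⟨?_, ?_⟩⟩
  · rintro ⟨c, hc⟩
    obtain ⟨ha, hb⟩ := length_of_isColouring _ hc
    exact ⟨ha, hb, hc.inputs.symm.trans ((hi W _).trans ((hs W _).symm.trans (hc.sources ()))),
      hc.outputs.symm.trans ((ho W _).trans ((ht W _).symm.trans (hc.targets ())))⟩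
  · rintro ⟨ha, hb, hs', ht'⟩
    let c : Fin (S.dom φ) ⊕ₗ Fin (S.cod φ) → W := fun v =>
      Sum.elim (fun i => a.get (i.cast ha.symm)) (fun i => b.get (i.cast hb.symm)) (ofLex v)
    have hca : (List.ofFn fun i => c (Sum.inlₗ i)) = a := by
      refine Eq.trans ?_ (List.ofFn_get a)
      exact List.ofFn_congr ha.symm _
    have hcb : (List.ofFn fun i => c (Sum.inrₗ i)) = b := by
      refine Eq.trans ?_ (List.ofFn_get b)
      exact List.ofFn_congr hb.symm _
    exact ⟨c, (hi W _).trans hca, (ho W _).trans hcb,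
      fun _ => (ht W _).trans (hcb.trans ht'), fun _ => (hs W _).trans (hca.trans hs')⟩

end Hyp

/-! ### Typed denotations -/

namespace Den

variable {S : Signature.{u}} {m n p q r s x y : ℕ}

instance : IsEmpty (Den.id S n).E := inferInstanceAs (IsEmpty Empty)

instance : IsEmpty (Den.swap S m n).E := inferInstanceAs (IsEmpty Empty)

instance (D D' : Den S) [IsEmpty D.E] [IsEmpty D'.E] : IsEmpty (D.seq D').E :=
  inferInstanceAs (IsEmpty (D.E ⊕ D'.E))

instance (D D' : Den S) [IsEmpty D.E] [IsEmpty D'.E] : IsEmpty (D.tensor D').E :=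
  inferInstanceAs (IsEmpty (D.E ⊕ D'.E))

instance (D : Den S) [IsEmpty D.E] : IsEmpty (D.trace x).E :=
  inferInstanceAs (IsEmpty D.E)

/-- The denotation relates lists of length `m` to lists of length `n`. -/
def HasType (D : Den S) (m n : ℕ) : Prop :=
  ∀ W a b t s, D.rel W a b t s → a.length = m ∧ b.length = n

theorem HasType.id (n : ℕ) : (Den.id S n).HasType n n := by
  rintro W a _ t s ⟨h, rfl⟩
  exact ⟨h, h⟩

theorem HasType.swap (m n : ℕ) : (Den.swap S m n).HasType (m + n) (n + m) := by
  rintro W _ _ t s ⟨u, v, rfl, rfl, rfl, rfl⟩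
  simp

theorem HasType.gen (φ : S.Label) : (Den.gen φ).HasType (S.dom φ) (S.cod φ) :=
  fun _ _ _ _ _ h => ⟨h.1, h.2.1⟩

theorem HasType.seq {D D' : Den S} (h : D.HasType m n) (h' : D'.HasType n p) :
    (D.seq D').HasType m p := by
  rintro W a b t s ⟨c, hc, hc'⟩
  exact ⟨(h _ _ _ _ _ hc).1, (h' _ _ _ _ _ hc').2⟩

theorem HasType.tensor {D D' : Den S} (h : D.HasType m n) (h' : D'.HasType p q) :
    (D.tensor D').HasType (m + p) (n + q) := by
  rintro W _ _ t s ⟨a₁, a₂, b₁, b₂, rfl, rfl, h₁, h₂⟩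
  rw [List.length_append, List.length_append, (h _ _ _ _ _ h₁).1, (h _ _ _ _ _ h₁).2,
    (h' _ _ _ _ _ h₂).1, (h' _ _ _ _ _ h₂).2]
  exact ⟨rfl, rfl⟩

theorem HasType.trace {D : Den S} (h : D.HasType (x + m) (x + n)) :
    (D.trace x).HasType m n := by
  rintro W a b t s ⟨c, hc, hr⟩
  have := h _ _ _ _ _ hr
  rw [List.length_append, List.length_append, hc] at this
  omega

section rel

variable {W : Type} {a a₁ a₂ b b₁ b₂ : List W}

theorem swap_rel_append {t s : (Den.swap S m n).E → List W} (h₁ : a₁.length = m)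
    (h₂ : a₂.length = n) : (Den.swap S m n).rel W (a₁ ++ a₂) b t s ↔ b = a₂ ++ a₁ := by
  constructor
  · rintro ⟨u, v, hu, hv, h, rfl⟩
    obtain ⟨rfl, rfl⟩ := List.append_inj h (h₁.trans hu.symm)
    rfl
  · rintro rfl
    exact ⟨a₁, a₂, h₁, h₂, rfl, rfl⟩

theorem swap_rel_append' {t s : (Den.swap S m n).E → List W} (h₁ : b₁.length = n)
    (h₂ : b₂.length = m) : (Den.swap S m n).rel W a (b₁ ++ b₂) t s ↔ a = b₂ ++ b₁ := by
  constructor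
  · rintro ⟨u, v, hu, hv, rfl, h⟩
    obtain ⟨rfl, rfl⟩ := List.append_inj h (h₁.trans hv.symm)
    rfl
  · rintro rfl
    exact ⟨b₂, b₁, h₂, h₁, rfl, rfl⟩

/-- The relation of a tensor lets the list be cut anywhere; the type of `D` forces the cut to fall
after `a₁`. -/
theorem tensor_rel_append {D D' : Den S} (h : D.HasType m n) (ha : a₁.length = m)
    {t s : (D.tensor D').E → List W} : (D.tensor D').rel W (a₁ ++ a₂) b t s ↔
      ∃ b₁ b₂, b = b₁ ++ b₂ ∧ D.rel W a₁ b₁ (t ∘ Sum.inl) (s ∘ Sum.inl) ∧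
        D'.rel W a₂ b₂ (t ∘ Sum.inr) (s ∘ Sum.inr) := by
  constructor
  · rintro ⟨a₁', a₂', b₁, b₂, h₁, rfl, h₂, h₃⟩
    obtain ⟨rfl, rfl⟩ := List.append_inj h₁ (ha.trans (h _ _ _ _ _ h₂).1.symm)
    exact ⟨b₁, b₂, rfl, h₂, h₃⟩
  · rintro ⟨b₁, b₂, rfl, h₂, h₃⟩
    exact ⟨_, _, _, _, rfl, rfl, h₂, h₃⟩

theorem tensor_rel_append' {D D' : Den S} (h : D.HasType m n) (hb : b₁.length = n)
    {t s : (D.tensor D').E → List W} : (D.tensor D').rel W a (b₁ ++ b₂) t s ↔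
      ∃ a₁ a₂, a = a₁ ++ a₂ ∧ D.rel W a₁ b₁ (t ∘ Sum.inl) (s ∘ Sum.inl) ∧
        D'.rel W a₂ b₂ (t ∘ Sum.inr) (s ∘ Sum.inr) := by
  constructor
  · rintro ⟨a₁, a₂, b₁', b₂', rfl, h₁, h₂, h₃⟩
    obtain ⟨rfl, rfl⟩ := List.append_inj h₁ (hb.trans (h _ _ _ _ _ h₂).2.symm)
    exact ⟨a₁, a₂, rfl, h₂, h₃⟩
  · rintro ⟨a₁, a₂, rfl, h₂, h₃⟩
    exact ⟨_, _, _, _, rfl, rfl, h₂, h₃⟩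

end rel

/-! ### The axioms of symmetric traced monoidal categories -/

theorem id_seq {D : Den S} (h : D.HasType m n) : ((Den.id S m).seq D).Equivalent D := by
  refine ⟨Equiv.emptySum _ _, by rintro (e | e); exacts [isEmptyElim e, rfl],
    fun W _ a b t s => ⟨?_, fun hr => ⟨a, ⟨(h _ _ _ _ _ hr).1, rfl⟩, hr⟩⟩⟩
  rintro ⟨_, ⟨-, rfl⟩, hr⟩
  exact hr

theorem seq_id {D : Den S} (h : D.HasType m n) : (D.seq (Den.id S n)).Equivalent D := by
  refine ⟨Equiv.sumEmpty _ _, by rintro (e | e); exacts [rfl, isEmptyElim e],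
    fun W _ a b t s => ⟨?_, fun hr => ⟨b, hr, ⟨(h _ _ _ _ _ hr).2, rfl⟩⟩⟩⟩
  rintro ⟨_, hr, ⟨-, rfl⟩⟩
  exact hr

theorem seq_assoc (D₁ D₂ D₃ : Den S) :
    ((D₁.seq D₂).seq D₃).Equivalent (D₁.seq (D₂.seq D₃)) := by
  refine ⟨Equiv.sumAssoc _ _ _, by rintro ((e | e) | e) <;> rfl, fun W _ a b t s => ⟨?_, ?_⟩⟩
  · rintro ⟨c, ⟨d, h₁, h₂⟩, h₃⟩
    exact ⟨d, h₁, c, h₂, h₃⟩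
  · rintro ⟨d, h₁, c, h₂, h₃⟩
    exact ⟨c, ⟨d, h₁, h₂⟩, h₃⟩

theorem tensor_id (m n : ℕ) :
    ((Den.id S m).tensor (Den.id S n)).Equivalent (Den.id S (m + n)) := by
  refine Equivalent.of_rel_iff fun W a b t s t' s' => ⟨?_, ?_⟩
  · rintro ⟨a₁, a₂, b₁, b₂, rfl, rfl, ⟨rfl, rfl⟩, ⟨rfl, rfl⟩⟩
    exact ⟨List.length_append, rfl⟩
  · rintro ⟨h, rfl⟩
    exact ⟨a.take m, a.drop m, _, _, (List.take_append_drop _ _).symm,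
      (List.take_append_drop _ _).symm, ⟨by simp [h], rfl⟩, ⟨by simp [h], rfl⟩⟩

/-- The two tensors cut the middle list independently. The types of `D₁` and `D₃` make the cuts
coincide. -/
theorem interchange {D₁ D₂ D₃ D₄ : Den S} (h₁ : D₁.HasType m n) (h₃ : D₃.HasType n p) :
    ((D₁.tensor D₂).seq (D₃.tensor D₄)).Equivalent ((D₁.seq D₃).tensor (D₂.seq D₄)) := by
  refine ⟨Equiv.sumSumSumComm _ _ _ _, by rintro ((e | e) | (e | e)) <;> rfl,
    fun W _ a b t s => ⟨?_, ?_⟩⟩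
  · rintro ⟨_, ⟨a₁, a₂, c₁, c₂, rfl, rfl, k₁, k₂⟩, k⟩
    obtain ⟨b₁, b₂, rfl, k₃, k₄⟩ := (tensor_rel_append h₃ (h₁ _ _ _ _ _ k₁).2).1 k
    exact ⟨_, _, _, _, rfl, rfl, ⟨_, k₁, k₃⟩, ⟨_, k₂, k₄⟩⟩
  · rintro ⟨_, _, _, _, rfl, rfl, ⟨_, k₁, k₃⟩, ⟨_, k₂, k₄⟩⟩
    exact ⟨_, ⟨_, _, _, _, rfl, rfl, k₁, k₂⟩, ⟨_, _, _, _, rfl, rfl, k₃, k₄⟩⟩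

theorem unit_tensor (D : Den S) : ((Den.id S 0).tensor D).Equivalent D := by
  refine ⟨Equiv.emptySum _ _, by rintro (e | e); exacts [isEmptyElim e, rfl],
    fun W _ a b t s => ⟨?_, fun hr => ⟨[], a, [], b, rfl, rfl, ⟨rfl, rfl⟩, hr⟩⟩⟩
  rintro ⟨a₁, a₂, b₁, b₂, rfl, rfl, ⟨h, rfl⟩, hr⟩
  rw [List.length_eq_zero_iff] at h
  subst h
  exact hr

theorem tensor_unit (D : Den S) : (D.tensor (Den.id S 0)).Equivalent D := by
  refine ⟨Equiv.sumEmpty _ _, by rintro (e | e); exacts [rfl, isEmptyElim e],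
    fun W _ a b t s => ⟨?_, fun hr => ⟨a, [], b, [], (List.append_nil _).symm,
      (List.append_nil _).symm, hr, ⟨rfl, rfl⟩⟩⟩⟩
  rintro ⟨a₁, a₂, b₁, b₂, rfl, rfl, hr, ⟨h, rfl⟩⟩
  rw [List.length_eq_zero_iff] at h
  subst h
  rw [List.append_nil, List.append_nil]
  exact hr

theorem tensor_assoc (D₁ D₂ D₃ : Den S) :
    ((D₁.tensor D₂).tensor D₃).Equivalent (D₁.tensor (D₂.tensor D₃)) := by
  refine ⟨Equiv.sumAssoc _ _ _, by rintro ((e | e) | e) <;> rfl, fun W _ a b t s => ⟨?_, ?_⟩⟩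
  · rintro ⟨_, _, _, _, rfl, rfl, ⟨_, _, _, _, rfl, rfl, h₁, h₂⟩, h₃⟩
    exact ⟨_, _, _, _, List.append_assoc _ _ _, List.append_assoc _ _ _, h₁,
      ⟨_, _, _, _, rfl, rfl, h₂, h₃⟩⟩
  · rintro ⟨_, _, _, _, rfl, rfl, h₁, ⟨_, _, _, _, rfl, rfl, h₂, h₃⟩⟩
    exact ⟨_, _, _, _, (List.append_assoc _ _ _).symm, (List.append_assoc _ _ _).symm,
      ⟨_, _, _, _, rfl, rfl, h₁, h₂⟩, h₃⟩

theorem swap_natural {D D' : Den S} (h : D.HasType m n) (h' : D'.HasType p q) :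
    ((D.tensor D').seq (Den.swap S n q)).Equivalent
      ((Den.swap S m p).seq (D'.tensor D)) := by
  refine ⟨(Equiv.sumEmpty _ _).trans ((Equiv.sumComm _ _).trans (Equiv.emptySum _ _).symm), ?_,
    fun W _ a b t s => ⟨?_, ?_⟩⟩
  · rintro ((e | e) | e)
    exacts [rfl, rfl, isEmptyElim e]
  · rintro ⟨_, ⟨a₁, a₂, c₁, c₂, rfl, rfl, k, k'⟩, hs⟩
    rw [swap_rel_append (h _ _ _ _ _ k).2 (h' _ _ _ _ _ k').2] at hs
    subst hs
    exact ⟨_, ⟨_, _, (h _ _ _ _ _ k).1, (h' _ _ _ _ _ k').1, rfl, rfl⟩,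
      ⟨_, _, _, _, rfl, rfl, k', k⟩⟩
  · rintro ⟨_, hs, ⟨a₁, a₂, c₁, c₂, rfl, rfl, k', k⟩⟩
    rw [swap_rel_append' (h' _ _ _ _ _ k').1 (h _ _ _ _ _ k).1] at hs
    subst hs
    exact ⟨_, ⟨_, _, _, _, rfl, rfl, k, k'⟩,
      ⟨_, _, (h _ _ _ _ _ k).2, (h' _ _ _ _ _ k').2, rfl, rfl⟩⟩

theorem swap_swap (m n : ℕ) :
    ((Den.swap S m n).seq (Den.swap S n m)).Equivalent (Den.id S (m + n)) := by
  refine Equivalent.of_rel_iff fun W a b t s t' s' => ⟨?_, ?_⟩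
  · rintro ⟨_, ⟨u, v, hu, hv, rfl, rfl⟩, k⟩
    rw [swap_rel_append hv hu] at k
    exact ⟨by rw [List.length_append, hu, hv], k.symm⟩
  · rintro ⟨h, rfl⟩
    have h₁ : (a.take m).length = m := by simp [h]
    have h₂ : (a.drop m).length = n := by simp [h]
    exact ⟨_, ⟨_, _, h₁, h₂, (List.take_append_drop m a).symm, rfl⟩,
      ⟨_, _, h₂, h₁, rfl, (List.take_append_drop m a).symm⟩⟩

theorem hexagon (m n p : ℕ) :
    (((Den.swap S m n).tensor (Den.id S p)).seq
      ((Den.id S n).tensor (Den.swap S m p))).Equivalent (Den.swap S m (n + p)) := by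
  refine Equivalent.of_rel_iff fun W a b t s t' s' => ⟨?_, ?_⟩
  · rintro ⟨_, ⟨_, w, _, _, rfl, rfl, ⟨u, v, hu, hv, rfl, rfl⟩, ⟨hw, rfl⟩⟩, k⟩
    rw [List.append_assoc, tensor_rel_append (HasType.id n) hv] at k
    obtain ⟨_, _, rfl, ⟨-, rfl⟩, k⟩ := k
    rw [swap_rel_append hu hw] at k
    subst k
    exact ⟨u, v ++ w, hu, by rw [List.length_append, hv, hw], List.append_assoc _ _ _,
      (List.append_assoc _ _ _).symm⟩
  · rintro ⟨u, w, hu, hw, rfl, rfl⟩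
    obtain ⟨v, w, rfl, hv, hw⟩ : ∃ v w', w = v ++ w' ∧ v.length = n ∧ w'.length = p :=
      ⟨w.take n, w.drop n, (List.take_append_drop _ _).symm, by simp [hw], by simp [hw]⟩
    refine ⟨v ++ u ++ w, ⟨u ++ v, w, _, _, (List.append_assoc _ _ _).symm, rfl,
      ⟨_, _, hu, hv, rfl, rfl⟩, ⟨hw, rfl⟩⟩, ?_⟩
    exact ⟨v, u ++ w, v, w ++ u, List.append_assoc _ _ _, List.append_assoc _ _ _, ⟨hv, rfl⟩,
      ⟨_, _, hu, hw, rfl, rfl⟩⟩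

theorem hexagon' (m n p : ℕ) :
    (((Den.id S m).tensor (Den.swap S n p)).seq
      ((Den.swap S m p).tensor (Den.id S n))).Equivalent (Den.swap S (m + n) p) := by
  refine Equivalent.of_rel_iff fun W a b t s t' s' => ⟨?_, ?_⟩
  · rintro ⟨_, ⟨u, _, _, _, rfl, rfl, ⟨hu, rfl⟩, ⟨v, w, hv, hw, rfl, rfl⟩⟩, k⟩
    rw [← List.append_assoc, tensor_rel_append (HasType.swap m p)
      (by rw [List.length_append, hu, hw])] at k
    obtain ⟨_, _, rfl, k, ⟨-, rfl⟩⟩ := k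
    rw [swap_rel_append hu hw] at k
    subst k
    exact ⟨u ++ v, w, by rw [List.length_append, hu, hv], hw, (List.append_assoc _ _ _).symm,
      List.append_assoc _ _ _⟩
  · rintro ⟨u, w, hu, hw, rfl, rfl⟩
    obtain ⟨u, v, rfl, hu, hv⟩ : ∃ v w', u = v ++ w' ∧ v.length = m ∧ w'.length = n :=
      ⟨u.take m, u.drop m, (List.take_append_drop _ _).symm, by simp [hu], by simp [hu]⟩
    refine ⟨u ++ (w ++ v), ⟨u, v ++ w, _, _, List.append_assoc _ _ _, rfl,
      ⟨hu, rfl⟩, ⟨_, _, hv, hw, rfl, rfl⟩⟩, ?_⟩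
    exact ⟨u ++ w, v, w ++ u, v, (List.append_assoc _ _ _).symm, (List.append_assoc _ _ _).symm,
      ⟨_, _, hu, hw, rfl, rfl⟩, ⟨hv, rfl⟩⟩

theorem tightening (x : ℕ) (D D₁ D₂ : Den S) :
    (((((Den.id S x).tensor D₁).seq D).seq ((Den.id S x).tensor D₂)).trace x).Equivalent
      ((D₁.seq (D.trace x)).seq D₂) := by
  refine ⟨Equiv.sumCongr (Equiv.sumCongr (Equiv.emptySum _ _) (Equiv.refl _))
    (Equiv.emptySum _ _), ?_, fun W _ a b t s => ⟨?_, ?_⟩⟩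
  · rintro (((e | e) | e) | (e | e))
    exacts [isEmptyElim e, rfl, rfl, isEmptyElim e, rfl]
  · rintro ⟨c, hc, d, ⟨d', k₁, k⟩, k₂⟩
    rw [tensor_rel_append (HasType.id x) hc] at k₁
    rw [tensor_rel_append' (HasType.id x) hc] at k₂
    obtain ⟨_, a', rfl, ⟨-, rfl⟩, k₁⟩ := k₁
    obtain ⟨_, b', rfl, ⟨-, rfl⟩, k₂⟩ := k₂
    exact ⟨b', ⟨a', k₁, _, hc, k⟩, k₂⟩
  · rintro ⟨b', ⟨a', k₁, c, hc, k⟩, k₂⟩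
    exact ⟨c, hc, _, ⟨_, ⟨_, _, _, _, rfl, rfl, ⟨hc, rfl⟩, k₁⟩, k⟩,
      ⟨_, _, _, _, rfl, rfl, ⟨hc, rfl⟩, k₂⟩⟩

/-- Both sides assert the existence of a colour list on each side of `D'` around the loop. They
differ only in which of the two lists is bound by the trace and which by the composition. -/
theorem sliding {D D' : Den S} (h : D.HasType (x + m) (y + n)) (h' : D'.HasType y x) :
    ((D.seq (D'.tensor (Den.id S n))).trace x).Equivalent
      (((D'.tensor (Den.id S m)).seq D).trace y) := by
  refine ⟨(Equiv.sumCongr (Equiv.refl _) (Equiv.sumEmpty _ _)).trans ((Equiv.sumComm _ _).trans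
    (Equiv.sumCongr (Equiv.sumEmpty _ _).symm (Equiv.refl _))), ?_, fun W _ a b t s => ⟨?_, ?_⟩⟩
  · rintro (e | (e | e))
    exacts [rfl, rfl, isEmptyElim e]
  · rintro ⟨c, hc, d, k, k'⟩
    rw [tensor_rel_append' h' hc] at k'
    obtain ⟨c', _, rfl, k', ⟨-, rfl⟩⟩ := k'
    have ha : a.length = m := by
      have := (h _ _ _ _ _ k).1
      rw [List.length_append] at this
      omega
    exact ⟨c', (h' _ _ _ _ _ k').1, _, ⟨_, _, _, _, rfl, rfl, k', ⟨ha, rfl⟩⟩, k⟩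
  · rintro ⟨c, hc, d, k', k⟩
    rw [tensor_rel_append h' hc] at k'
    obtain ⟨c', _, rfl, k', ⟨-, rfl⟩⟩ := k'
    have hb : b.length = n := by
      have := (h _ _ _ _ _ k).2
      rw [List.length_append] at this
      omega
    exact ⟨c', (h' _ _ _ _ _ k').2, _, k, ⟨_, _, _, _, rfl, rfl, k', ⟨hb, rfl⟩⟩⟩

theorem superposing {D D' : Den S} (h : D.HasType (x + m) (x + n)) :
    ((D.tensor D').trace x).Equivalent ((D.trace x).tensor D') := by
  refine ⟨Equiv.refl _, fun _ => rfl, fun W _ a b t s => ⟨?_, ?_⟩⟩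
  · rintro ⟨c, hc, a', a₂, b', b₂, ha, hb, k, k'⟩
    obtain ⟨hla, hlb⟩ := h _ _ _ _ _ k
    -- The type of `D` makes `a'` at least as long as `c`, so the tensor cuts `c ++ a` no earlier
    -- than the end of `c`. The other alternative is possible only when `a'` equals `c`.
    obtain ⟨a₁, rfl⟩ : ∃ a₁, a' = c ++ a₁ := by
      obtain ⟨a₁, rfl, -⟩ | ⟨c', rfl, rfl⟩ := List.append_eq_append_iff.1 ha
      · exact ⟨a₁, rfl⟩
      · rw [List.length_append] at hc
        obtain rfl : c' = [] := List.length_eq_zero_iff.1 (by omega)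
        exact ⟨[], by simp⟩
    obtain ⟨b₁, rfl⟩ : ∃ b₁, b' = c ++ b₁ := by
      obtain ⟨b₁, rfl, -⟩ | ⟨c', h', rfl⟩ := List.append_eq_append_iff.1 hb
      · exact ⟨b₁, rfl⟩
      · rw [h', List.length_append] at hc
        obtain rfl : c' = [] := List.length_eq_zero_iff.1 (by omega)
        exact ⟨[], by simp [h']⟩
    rw [List.append_assoc] at ha hb
    exact ⟨a₁, a₂, b₁, b₂, List.append_cancel_left ha, List.append_cancel_left hb,
      ⟨c, hc, k⟩, k'⟩
  · rintro ⟨a₁, a₂, b₁, b₂, rfl, rfl, ⟨c, hc, k⟩, k'⟩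
    exact ⟨c, hc, _, _, _, _, (List.append_assoc _ _ _).symm, (List.append_assoc _ _ _).symm,
      k, k'⟩

/-- The equations `c ++ a = u ++ v` and `c ++ b = v ++ u`, with blocks of equal length, force all
the lists to be equal. -/
theorem yanking (x : ℕ) : ((Den.swap S x x).trace x).Equivalent (Den.id S x) := by
  refine Equivalent.of_rel_iff fun W a b t s t' s' => ⟨?_, ?_⟩
  · rintro ⟨c, hc, u, v, hu, hv, h₁, h₂⟩
    obtain ⟨rfl, rfl⟩ := List.append_inj h₁ (hc.trans hu.symm)
    obtain ⟨rfl, rfl⟩ := List.append_inj h₂ (hc.trans hv.symm)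
    exact ⟨hv, rfl⟩
  · rintro ⟨h, rfl⟩
    exact ⟨a, h, a, a, h, h, rfl, rfl⟩

/-- Two existential quantifiers commute; the conjugating swaps put the two feedback blocks back in
the order `D` expects. -/
theorem exchange {D : Den S} (h : D.HasType (x + y + m) (x + y + n)) :
    ((D.trace x).trace y).Equivalent
      ((((((Den.swap S y x).tensor (Den.id S m)).seq D).seq
        ((Den.swap S x y).tensor (Den.id S n))).trace y).trace x) := by
  refine Equivalent.symm ⟨(Equiv.sumEmpty _ _).trans (Equiv.emptySum _ _), ?_,
    fun W _ a b t s => ⟨?_, ?_⟩⟩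
  · rintro ((e | e) | e)
    exacts [isEmptyElim e, rfl, isEmptyElim e]
  · rintro ⟨c, hc, d, hd, f, ⟨f', k₁, k⟩, k₂⟩
    rw [← List.append_assoc, tensor_rel_append (HasType.swap y x)
      (by rw [List.length_append, hc, hd])] at k₁
    rw [← List.append_assoc, tensor_rel_append' (HasType.swap x y)
      (by rw [List.length_append, hc, hd])] at k₂
    obtain ⟨_, a', rfl, k₁, ⟨-, rfl⟩⟩ := k₁
    obtain ⟨_, b', rfl, k₂, ⟨-, rfl⟩⟩ := k₂
    rw [swap_rel_append hd hc] at k₁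
    rw [swap_rel_append' hd hc] at k₂
    subst k₁ k₂
    rw [List.append_assoc, List.append_assoc] at k
    exact ⟨d, hd, c, hc, k⟩
  · rintro ⟨d, hd, c, hc, k⟩
    have hl := h _ _ _ _ _ k
    simp only [List.length_append, hc, hd] at hl
    rw [← List.append_assoc, ← List.append_assoc] at k
    exact ⟨c, hc, d, hd, _, ⟨_, ⟨_, _, _, _, (List.append_assoc _ _ _).symm, rfl,
      ⟨_, _, hd, hc, rfl, rfl⟩, ⟨by omega, rfl⟩⟩, k⟩,
      ⟨_, _, _, _, rfl, (List.append_assoc _ _ _).symm, ⟨_, _, hc, hd, rfl, rfl⟩,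
        ⟨by omega, rfl⟩⟩⟩

end Den

/-! ### Swaps of empty and composite blocks -/

namespace Den

variable {S : Signature.{u}}

theorem zero_swap (n : ℕ) : (Den.id S n).Equivalent (Den.swap S 0 n) := by
  refine Equivalent.of_rel_iff fun W a b t s t' s' => ⟨?_, ?_⟩
  · rintro ⟨h, rfl⟩
    exact ⟨[], a, rfl, h, rfl, (List.append_nil a).symm⟩
  · rintro ⟨u, v, hu, hv, rfl, rfl⟩
    rw [List.length_eq_zero_iff] at hu
    subst hu
    exact ⟨hv, (List.append_nil v).symm⟩

theorem swap_zero (m : ℕ) : (Den.id S m).Equivalent (Den.swap S m 0) := by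
  refine Equivalent.of_rel_iff fun W a b t s t' s' => ⟨?_, ?_⟩
  · rintro ⟨h, rfl⟩
    exact ⟨a, [], h, rfl, (List.append_nil a).symm, rfl⟩
  · rintro ⟨u, v, hu, hv, rfl, rfl⟩
    rw [List.length_eq_zero_iff] at hv
    subst hv
    exact ⟨by rwa [List.append_nil], List.append_nil u⟩

/-- A swap of two pairs of blocks, by swaps of the single blocks. -/
theorem swap_add_add (m m' n n' : ℕ) :
    (((((Den.id S m).tensor (Den.swap S m' n)).tensor (Den.id S n')).seq
      ((Den.swap S m n).tensor (Den.swap S m' n'))).seq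
        (((Den.id S n).tensor (Den.swap S m n')).tensor (Den.id S m'))).Equivalent
      (Den.swap S (m + m') (n + n')) := by
  refine Equivalent.of_rel_iff fun W a b t s t' s' => ⟨?_, ?_⟩
  · rintro ⟨_, ⟨_, ⟨_, z, _, _, rfl, rfl, ⟨u, _, _, _, rfl, rfl, ⟨hu, rfl⟩,
      ⟨v, w, hv, hw, rfl, rfl⟩⟩, ⟨hz, rfl⟩⟩, k⟩, k'⟩
    rw [← List.append_assoc, List.append_assoc, tensor_rel_append (HasType.swap m n)
      (by rw [List.length_append, hu, hw])] at k
    obtain ⟨_, _, rfl, k₁, k₂⟩ := k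
    rw [swap_rel_append hu hw] at k₁
    rw [swap_rel_append hv hz] at k₂
    subst k₁ k₂
    rw [← List.append_assoc, tensor_rel_append ((HasType.id n).tensor (HasType.swap m n'))
      (by simp only [List.length_append]; omega)] at k'
    obtain ⟨_, _, rfl, k₁, ⟨-, rfl⟩⟩ := k'
    rw [List.append_assoc, tensor_rel_append (HasType.id n) hw] at k₁
    obtain ⟨_, _, rfl, ⟨-, rfl⟩, k₂⟩ := k₁
    rw [swap_rel_append hu hz] at k₂
    subst k₂
    exact ⟨u ++ v, w ++ z, by rw [List.length_append, hu, hv],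
      by rw [List.length_append, hw, hz], by simp only [List.append_assoc],
      by simp only [List.append_assoc]⟩
  · rintro ⟨u, w, hu, hw, rfl, rfl⟩
    obtain ⟨u, v, rfl, hu, hv⟩ : ∃ v w', u = v ++ w' ∧ v.length = m ∧ w'.length = m' :=
      ⟨u.take m, u.drop m, (List.take_append_drop _ _).symm, by simp [hu], by simp [hu]⟩
    obtain ⟨w, z, rfl, hw, hz⟩ : ∃ v w', w = v ++ w' ∧ v.length = n ∧ w'.length = n' :=
      ⟨w.take n, w.drop n, (List.take_append_drop _ _).symm, by simp [hw], by simp [hw]⟩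
    refine ⟨(w ++ u) ++ (z ++ v), ⟨(u ++ w) ++ (v ++ z), ?_, ?_⟩, ?_⟩
    · exact ⟨u ++ (v ++ w), z, u ++ (w ++ v), z, by simp only [List.append_assoc],
        by simp only [List.append_assoc],
        ⟨_, _, _, _, rfl, rfl, ⟨hu, rfl⟩, ⟨_, _, hv, hw, rfl, rfl⟩⟩, ⟨hz, rfl⟩⟩
    · exact ⟨_, _, _, _, rfl, rfl, ⟨_, _, hu, hw, rfl, rfl⟩, ⟨_, _, hv, hz, rfl, rfl⟩⟩
    · exact ⟨w ++ (u ++ z), v, w ++ (z ++ u), v, by simp only [List.append_assoc],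
        by simp only [List.append_assoc],
        ⟨_, _, _, _, rfl, rfl, ⟨hw, rfl⟩, ⟨_, _, hu, hz, rfl, rfl⟩⟩, ⟨hv, rfl⟩⟩

end Den

/-! ### The denotations of the recursively built swaps -/

namespace Hyp

variable {S : Signature.{u}} {m n p q : ℕ}

theorem den_seq' {F : Hyp S m n} {G : Hyp S n p} {D D' : Den S} (h : F.den.Equivalent D)
    (h' : G.den.Equivalent D') : (F.seq G).den.Equivalent (D.seq D') :=
  (den_seq F G).trans (h.seq h')

theorem den_tensor' {F : Hyp S m n} {G : Hyp S p q} {D D' : Den S} (h : F.den.Equivalent D)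
    (h' : G.den.Equivalent D') : (F.tensor G).den.Equivalent (D.tensor D') :=
  (den_tensor F G).trans (h.tensor h')

/-- Definitional, since casting keeps the underlying labelled hypergraph and only that enters the
denotation. -/
theorem den_cast {m' n' : ℕ} {F : Hyp S m n} {D : Den S} (hm : m = m') (hn : n = n')
    (h : F.den.Equivalent D) : (F.cast hm hn).den.Equivalent D := h

/-- Each recursive step is an instance of a hexagon, here and in `den_swapRight`. -/
theorem den_swapLeft : ∀ m, (swapLeft S m).den.Equivalent (Den.swap S m 1)
  | 0 => (den_id 1).trans (Den.zero_swap 1)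
  | 1 => den_swap₁₁
  | m + 2 => by
    rw [swapLeft]
    exact den_cast _ _ ((den_seq' (den_tensor' (den_id (m + 1)) den_swap₁₁)
      (den_cast _ _ (den_tensor' (den_swapLeft (m + 1)) (den_id 1)))).trans
        (Den.hexagon' (m + 1) 1 1))

theorem den_swapRight : ∀ n, (swapRight S n).den.Equivalent (Den.swap S 1 n)
  | 0 => (den_id 1).trans (Den.swap_zero 1)
  | 1 => den_swap₁₁
  | n + 2 => by
    rw [swapRight]
    exact den_cast _ _ ((den_seq' (den_tensor' (den_swapRight (n + 1)) (den_id 1))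
      (den_cast _ _ (den_tensor' (den_id (n + 1)) den_swap₁₁))).trans (Den.hexagon 1 (n + 1) 1))

/-- The recursive step splits one wire off the end of each block, which is `Den.swap_add_add` with
`m' = n' = 1`. -/
theorem den_swap : ∀ m n, (swap S m n).den.Equivalent (Den.swap S m n)
  | 0, n => by
    rw [swap]
    exact den_cast _ _ ((den_id n).trans (Den.zero_swap n))
  | m + 1, 0 => by
    rw [swap]
    exact den_cast _ _ ((den_id (m + 1)).trans (Den.swap_zero (m + 1)))
  | 1, n + 1 => by
    rw [swap]
    exact den_swapRight (n + 1)
  | m + 2, 1 => by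
    rw [swap]
    exact den_swapLeft (m + 2)
  | m + 2, n + 2 => by
    rw [swap]
    exact den_cast _ _ ((den_seq' (den_seq'
      (den_tensor' (den_tensor' (den_id (m + 1)) (den_swapRight (n + 1))) (den_id 1))
      (den_cast _ _ (den_tensor' (den_swap (m + 1) (n + 1)) den_swap₁₁)))
      (den_cast _ _ (den_tensor' (den_tensor' (den_id (n + 1)) (den_swapLeft (m + 1)))
        (den_id 1)))).trans (Den.swap_add_add (m + 1) 1 (n + 1) 1))

end Hyp

/-! ### Soundness for terms -/

namespace Term

variable {S : Signature.{u}}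

/-- The relational denotation of a term. -/
def den : {m n : ℕ} → Term S m n → Den S
  | _, _, gen φ => Den.gen φ
  | _, _, id n => Den.id S n
  | _, _, swap m n => Den.swap S m n
  | _, _, seq f g => f.den.seq g.den
  | _, _, tensor f g => f.den.tensor g.den
  | _, _, trace x f => f.den.trace x

theorem den_hasType : ∀ {m n : ℕ} (f : Term S m n), f.den.HasType m n
  | _, _, gen φ => .gen φ
  | _, _, id n => .id n
  | _, _, swap m n => .swap m n
  | _, _, seq f g => f.den_hasType.seq g.den_hasType
  | _, _, tensor f g => f.den_hasType.tensor g.den_hasType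
  | _, _, trace _ f => f.den_hasType.trace

theorem den_interp : ∀ {m n : ℕ} (f : Term S m n), f.interp.den.Equivalent f.den
  | _, _, gen φ => Hyp.den_gen φ
  | _, _, id n => Hyp.den_id n
  | _, _, swap m n => Hyp.den_swap m n
  | _, _, seq f g => Hyp.den_seq' f.den_interp g.den_interp
  | _, _, tensor f g => Hyp.den_tensor' f.den_interp g.den_interp
  | _, _, trace x f => (Hyp.den_trace x f.interp).trans (f.den_interp.trace x)

/-- Denotations carry no arities, so strict associativity and unitality of objects cost nothing;
arities enter through `Den.HasType` where an axiom depends on them. -/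
theorem den_cast {m n m' n' : ℕ} (hm : m = m') (hn : n = n') (f : Term S m n) :
    (f.cast hm hn).den = f.den := by
  subst hm hn
  rfl

theorem StmcEq.den_equivalent {m n : ℕ} {f g : Term S m n} (h : StmcEq f g) :
    f.den.Equivalent g.den := by
  induction h with
  | refl f => exact .refl _
  | symm _ ih => exact ih.symm
  | trans _ _ ih ih' => exact ih.trans ih'
  | seq_congr _ _ ih ih' => exact ih.seq ih'
  | tensor_congr _ _ ih ih' => exact ih.tensor ih'
  | trace_congr x _ ih => exact ih.trace x
  | id_seq f => exact Den.id_seq f.den_hasType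
  | seq_id f => exact Den.seq_id f.den_hasType
  | seq_assoc f g h => exact Den.seq_assoc _ _ _
  | tensor_id m n => exact Den.tensor_id m n
  | interchange f g h k => exact Den.interchange f.den_hasType h.den_hasType
  | unit_tensor f => rw [den_cast]; exact Den.unit_tensor _
  | tensor_unit f => rw [den_cast]; exact Den.tensor_unit _
  | tensor_assoc f g h => rw [den_cast]; exact Den.tensor_assoc _ _ _
  | swap_natural f g => exact Den.swap_natural f.den_hasType g.den_hasType
  | swap_swap m n => exact Den.swap_swap m n
  | hexagon m n p => simp only [den, den_cast]; exact Den.hexagon m n p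
  | hexagon' m n p => simp only [den, den_cast]; exact Den.hexagon' m n p
  | tightening x g f h => exact Den.tightening x _ _ _
  | sliding x y f g => exact Den.sliding f.den_hasType g.den_hasType
  | vanishing_zero f => rw [den_cast]; exact Den.vanishing_zero _
  | vanishing_add x y f => simp only [den, den_cast]; exact Den.vanishing_add x y _
  | superposing x f g => simp only [den, den_cast]; exact Den.superposing f.den_hasType
  | yanking x => exact Den.yanking x
  | exchange x y f => simp only [den, den_cast]; exact Den.exchange f.den_hasType

end Term

theorem mainTheorem2 (S : Signature.{u}) {m n : ℕ} (f g : Term S m n) (h : Term.StmcEq f g) :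
    f.interp.toLabelledLinearHypergraph.Isomorphic g.interp.toLabelledLinearHypergraph :=
  LabelledLinearHypergraph.isomorphic_of_equivalent
    ((f.den_interp.trans h.den_equivalent).trans g.den_interp.symm)
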